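/- Let $D=\{d_1,\dots,d_n\}$ be a set of $n$ disks in the plane, where $d_i$ has centre $p_i$ and radius $r_i>0$ (different disks may have the same centre). An \emph{assignment} is a map $\phi:D\to D$ with $\phi(\phi(d_i))=\phi(d_i)$ for all $i$; $d_i$ is \emph{selected} if $\phi(d_i)=d_i$, and otherwise it is \emph{merged with} $\phi(d_i)$. The \emph{cardinality} of $\phi$ is the number of selected disks, and the \emph{aggregate radius} of a selected disk $d_i$ is $r_i(\phi)=\sum_{\phi(d_j)=d_i} r_j$. Let $\delta_i$ be the sequence of the disks of $D\setminus\{d_i\}$, ordered increasingly by the distance of their centres from $p_i$, equal distances being ordered by index. The assignment $\phi$ is \emph{proper} if: 1. whenever $\delta_i(j)$ is merged with $d_i$, so are $\delta_i(1),\dots,\delta_i(j-1)$; 2. whenever $\delta_i(j)$ is merged with $d_i$, the distance between the centre of $\delta_i(j)$ and $p_i$ is less than $r_i+\sum_{k<j} r_{\delta_i(k)}$; 3. no selected disk, with its aggregate radius, contains the centre of another selected disk: $|p_ip_j|\ge \max(r_i(\phi),r_j(\phi))$ for any two selected disks $d_i\neq d_j$. **Theorem.** When all disk centres are collinear, a proper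 assignment of maximum cardinality can be computed in polynomial time: there are one program for a real RAM (unit-cost addition, subtraction, multiplication and comparison of real numbers; unit-cost addition, truncated subtraction and comparison of natural numbers, and indexed memory access) and one polynomial $T$ such that for every $n$ and all disks $d_1,\dots,d_n$ with collinear centres, given by $n$, the coordinates of the centres and the radii, the program halts after at most $T(n)$ steps and outputs a proper assignment of maximum cardinality, or reports that no proper assignment exists if that is the case. -/

import Mathlib

open scoped BigOperators

noncomputable section

/-! ### Disks and proper assignments -/

/-- A disk in the Euclidean plane, given by its centre and its (positive) radius. -/
structure Disk where
  centre : EuclideanSpace ℝ (Fin 2)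
  radius : ℝ
  radius_pos : 0 < radius

namespace Disk

variable {n : ℕ}

/-- An assignment: a map from the disks to themselves with `φ (φ i) = φ i`.
The disk `i` is selected if `φ i = i`; otherwise it is merged with the disk `φ i`. -/
def IsAssignment (φ : Fin n → Fin n) : Prop :=
  ∀ i, φ (φ i) = φ i

/-- The cardinality of an assignment: the number of selected disks. -/
def cardinality (φ : Fin n → Fin n) : ℕ :=
  (Finset.univ.filter fun i => φ i = i).card

/-- The distance between two disks is the distance between their centres. -/
def distance (D : Fin n → Disk) (i j : Fin n) : ℝ :=
  dist (D i).centre (D j).centre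

/-- The aggregate radius of the disk `i`: the sum of the radii of all disks assigned to it
(for a selected disk, this includes the disk itself). -/
def aggregateRadius (D : Fin n → Disk) (φ : Fin n → Fin n) (i : Fin n) : ℝ :=
  ∑ j ∈ Finset.univ.filter (fun j => φ j = i), (D j).radius

/-- `Precedes D i k j`: in the sequence of all disks other than `i`, ordered increasingly by
their distance from `i` (equal distances: by index), the disk `k` comes before the disk `j`. -/
def Precedes (D : Fin n → Disk) (i k j : Fin n) : Prop :=
  k ≠ i ∧ j ≠ i ∧
    (distance D i k < distance D i j ∨ (distance D i k = distance D i j ∧ k < j))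

open Classical in
/-- The radius of the disk `i` after all the disks that precede `j` in the sequence of `i`
have been merged with `i`. -/
def radiusBefore (D : Fin n → Disk) (i j : Fin n) : ℝ :=
  (D i).radius + ∑ k ∈ Finset.univ.filter (fun k => Precedes D i k j), (D k).radius

/-- Proper assignments. -/
structure IsProper (D : Fin n → Disk) (φ : Fin n → Fin n) : Prop where
  isAssignment : IsAssignment φ
  /-- A disk `j` is merged with `i` only if all disks preceding `j` are merged with `i`. -/
  merged_of_precedes : ∀ i j k, j ≠ i → φ j = i → Precedes D i k j → φ k = i
  /-- A disk `j` is merged with `i` only if its centre lies in `i` (strictly) after the disks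
  preceding `j` have been merged with `i`. -/
  distance_lt : ∀ i j, j ≠ i → φ j = i → distance D i j < radiusBefore D i j
  /-- No selected disk, with its aggregate radius, contains the centre of another one. -/
  centre_disjoint : ∀ i j, i ≠ j → φ i = i → φ j = j → aggregateRadius D φ i ≤ distance D i j

/-- Proper assignments of maximum cardinality. -/
def IsMaximumProper (D : Fin n → Disk) (φ : Fin n → Fin n) : Prop :=
  IsProper D φ ∧ ∀ ψ : Fin n → Fin n, IsProper D ψ → cardinality ψ ≤ cardinality φ

end Disk

/-! ### The real RAM

A program works on finitely many integer arrays and finitely many real arrays (those whose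
names it mentions), each indexed by natural numbers. Arithmetic on naturals is addition and
truncated subtraction; arithmetic on reals is addition, subtraction and multiplication. There is
no rounding, and no conversion from reals to naturals other than by comparisons. Each elementary
operation (literal, memory access, arithmetic operation, comparison, Boolean operation,
control transfer) costs one step. -/

namespace RealRAM

/-- The contents of the memory: `nat a k` and `real a k` are the `k`-th entries of the integer
array and of the real array named `a`. -/
structure State where
  nat : ℕ → ℕ → ℕ
  real : ℕ → ℕ → ℝ

/-- Expressions for natural numbers. -/
inductive NExp where
  | lit (k : ℕ)
  | load (a : ℕ) (idx : NExp)
  | add (e f : NExp)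
  | sub (e f : NExp)

/-- Expressions for real numbers. -/
inductive RExp where
  | lit (k : ℕ)
  | load (a : ℕ) (idx : NExp)
  | add (e f : RExp)
  | sub (e f : RExp)
  | mul (e f : RExp)

/-- Tests. -/
inductive BExp where
  | nle (e f : NExp)
  | rle (e f : RExp)
  | not (b : BExp)
  | and (b c : BExp)

/-- Programs. -/
inductive Prog where
  | skip
  | nstore (a : ℕ) (idx : NExp) (e : NExp)
  | rstore (a : ℕ) (idx : NExp) (e : RExp)
  | seq (p q : Prog)
  | ite (b : BExp) (p q : Prog)
  | loop (b : BExp) (p : Prog)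

def NExp.eval (s : State) : NExp → ℕ
  | .lit k => k
  | .load a idx => s.nat a (idx.eval s)
  | .add e f => e.eval s + f.eval s
  | .sub e f => e.eval s - f.eval s

def NExp.cost : NExp → ℕ
  | .lit _ => 1
  | .load _ idx => idx.cost + 1
  | .add e f => e.cost + f.cost + 1
  | .sub e f => e.cost + f.cost + 1

def RExp.eval (s : State) : RExp → ℝ
  | .lit k => k
  | .load a idx => s.real a (idx.eval s)
  | .add e f => e.eval s + f.eval s
  | .sub e f => e.eval s - f.eval s
  | .mul e f => e.eval s * f.eval s

def RExp.cost : RExp → ℕ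
  | .lit _ => 1
  | .load _ idx => idx.cost + 1
  | .add e f => e.cost + f.cost + 1
  | .sub e f => e.cost + f.cost + 1
  | .mul e f => e.cost + f.cost + 1

def BExp.eval (s : State) : BExp → Prop
  | .nle e f => e.eval s ≤ f.eval s
  | .rle e f => e.eval s ≤ f.eval s
  | .not b => ¬ b.eval s
  | .and b c => b.eval s ∧ c.eval s

def BExp.cost : BExp → ℕ
  | .nle e f => e.cost + f.cost + 1
  | .rle e f => e.cost + f.cost + 1
  | .not b => b.cost + 1
  | .and b c => b.cost + c.cost + 1

/-- Write `v` to position `k` of the integer array `a`. -/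
def State.setNat (s : State) (a k v : ℕ) : State :=
  { s with nat := Function.update s.nat a (Function.update (s.nat a) k v) }

/-- Write `v` to position `k` of the real array `a`. -/
def State.setReal (s : State) (a k : ℕ) (v : ℝ) : State :=
  { s with real := Function.update s.real a (Function.update (s.real a) k v) }

/-- `Runs p s s' t`: started in memory state `s`, the program `p` halts in memory state `s'`
after exactly `t` steps. -/
inductive Runs : Prog → State → State → ℕ → Prop
  | skip (s : State) : Runs .skip s s 1
  | nstore (s : State) (a : ℕ) (idx e : NExp) :
      Runs (.nstore a idx e) s (s.setNat a (idx.eval s) (e.eval s)) (idx.cost + e.cost + 1)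
  | rstore (s : State) (a : ℕ) (idx : NExp) (e : RExp) :
      Runs (.rstore a idx e) s (s.setReal a (idx.eval s) (e.eval s)) (idx.cost + e.cost + 1)
  | seq {p q : Prog} {s s' s'' : State} {t u : ℕ} :
      Runs p s s' t → Runs q s' s'' u → Runs (.seq p q) s s'' (t + u)
  | ite_true {b : BExp} {p q : Prog} {s s' : State} {t : ℕ} :
      b.eval s → Runs p s s' t → Runs (.ite b p q) s s' (b.cost + t + 1)
  | ite_false {b : BExp} {p q : Prog} {s s' : State} {t : ℕ} :
      ¬ b.eval s → Runs q s s' t → Runs (.ite b p q) s s' (b.cost + t + 1)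
  | loop_done {b : BExp} {p : Prog} {s : State} :
      ¬ b.eval s → Runs (.loop b p) s s (b.cost + 1)
  | loop_step {b : BExp} {p : Prog} {s s' s'' : State} {t u : ℕ} :
      b.eval s → Runs p s s' t → Runs (.loop b p) s' s'' u →
        Runs (.loop b p) s s'' (b.cost + t + u + 1)

/-- The first `n` entries of an array are `f 0, …, f (n - 1)`, all others are zero. -/
def arrayOf {n : ℕ} (f : Fin n → ℝ) (k : ℕ) : ℝ :=
  if h : k < n then f ⟨k, h⟩ else 0

/-- The initial memory for the disks `D 0, …, D (n - 1)`: the number `n` is entry `0` of the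
integer array `0`; the real arrays `0`, `1`, `2` hold the first coordinates of the centres, the
second coordinates of the centres, and the radii; everything else is zero. -/
def input {n : ℕ} (D : Fin n → Disk) : State where
  nat a k := if a = 0 ∧ k = 0 then n else 0
  real a :=
    if a = 0 then arrayOf fun i => (D i).centre 0
    else if a = 1 then arrayOf fun i => (D i).centre 1
    else if a = 2 then arrayOf fun i => (D i).radius
    else fun _ => 0

/-- The final memory solves the instance `D`: either entry `0` of the integer array `0` is `1` and
the first `n` entries of the integer array `1` are the values of a proper assignment of maximum
cardinality, or entry `0` of the integer array `0` is `0` and there is no proper assignment. -/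
def Solves {n : ℕ} (D : Fin n → Disk) (s : State) : Prop :=
  (s.nat 0 0 = 1 ∧
    ∃ φ : Fin n → Fin n, Disk.IsMaximumProper D φ ∧ ∀ i : Fin n, s.nat 1 i = φ i) ∨
  (s.nat 0 0 = 0 ∧ ¬ ∃ φ : Fin n → Fin n, Disk.IsProper D φ)

end RealRAM

end

/-! Let `t` be a coordinate along the common line. By condition 1 the disks merged with a selected
disk `i` form a prefix of the sequence of `i`, so `i` and the last disk `j` of that prefix determine
the whole cluster: only `n ^ 2` groups `(i, j)` can occur (`IsProper.exists_group_eq`).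

Conditions 2 and 3 forbid a second selected disk at the position of any member of a cluster.
Together with condition 1 this puts disks with equal centres into one cluster
(`IsProper.apply_eq_of_position_eq`) and keeps clusters from interleaving on the line
(`IsProper.position_lt_iff`). A proper assignment of a nonempty family is therefore a left-to-right
sequence of valid groups, each beginning where its predecessor ends. Condition 3 needs checking only
for neighbouring groups, since the nearest selected centre on each side is that of a neighbour
(`IsChain.sumRadius_le`). Conversely every such chain yields a proper assignment whose cardinality
is the length of the chain (`IsChain.isProper`, `IsChain.cardinality_eq`).

The maximum is found by dynamic programming: entry `(l, i, j)` of a table tells whether some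
sequence of `l + 1` groups starts with `(i, j)` and reaches the right end. The greatest `l` attained
by a group with nothing to its left gives the cardinality, and tracing the table back gives the
groups. All tests avoid roots and division: distances are compared through their squares, the order
along the line is the lexicographic order of the centres, and the boundary between two groups is
encoded by the number of disks to its left (`IsLower.eq_of_card_eq`).

The program is not written out by hand. Functions, predicates and memory updates computable in
polynomial time are closed under the constructions used by the algorithm, so a program is extracted
from the mathematical description `solveCmd`, and correctness is proved for that description alone.
-/

namespace RealRAM

/-! ### A calculus of polynomial-time computations on the real RAM -/

@[simp] theorem State.setNat_nat (s : State) (a k v : ℕ) :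
    (s.setNat a k v).nat = Function.update s.nat a (Function.update (s.nat a) k v) := rfl

@[simp] theorem State.setNat_real (s : State) (a k v : ℕ) : (s.setNat a k v).real = s.real := rfl

@[simp] theorem State.setReal_nat (s : State) (a k : ℕ) (v : ℝ) :
    (s.setReal a k v).nat = s.nat := rfl

@[simp] theorem State.setReal_real (s : State) (a k : ℕ) (v : ℝ) :
    (s.setReal a k v).real = Function.update s.real a (Function.update (s.real a) k v) := rfl

/-- The arrays with names below `d` have the same contents in both states. -/
def AgreeBelow (d : ℕ) (s s' : State) : Prop :=
  ∀ a < d, s'.nat a = s.nat a ∧ s'.real a = s.real a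

theorem AgreeBelow.refl (d : ℕ) (s : State) : AgreeBelow d s s := fun _ _ => ⟨rfl, rfl⟩

theorem AgreeBelow.trans {d : ℕ} {s s' s'' : State} (h : AgreeBelow d s s')
    (h' : AgreeBelow d s' s'') : AgreeBelow d s s'' := fun a ha =>
  ⟨(h' a ha).1.trans (h a ha).1, (h' a ha).2.trans (h a ha).2⟩

theorem AgreeBelow.mono {d e : ℕ} {s s' : State} (h : AgreeBelow d s s') (he : e ≤ d) :
    AgreeBelow e s s' := fun a ha => h a (ha.trans_le he)

theorem agreeBelow_setNat {d a : ℕ} (h : d ≤ a) (s : State) (k v : ℕ) :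
    AgreeBelow d s (s.setNat a k v) := fun b hb => by
  simp [Function.update_of_ne (show b ≠ a by omega)]

theorem agreeBelow_setReal {d a : ℕ} (h : d ≤ a) (s : State) (k : ℕ) (v : ℝ) :
    AgreeBelow d s (s.setReal a k v) := fun b hb => by
  simp [Function.update_of_ne (show b ≠ a by omega)]

/-- Types of tuples of local variables, each of which is kept in entry `0` of an integer array
whose name is at least `10`. A layout tells the names of these arrays, all of which are
below its size. -/
class Vars (V : Type) where
  Layout : Type
  size : Layout → ℕ
  holds : Layout → V → State → Prop
  ten_le_size : ∀ ℓ, 10 ≤ size ℓ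
  holds_congr : ∀ ℓ v s s', holds ℓ v s →
    (∀ a, 10 ≤ a → a < size ℓ → s'.nat a = s.nat a) → holds ℓ v s'

instance : Vars Unit where
  Layout := Unit
  size _ := 10
  holds _ _ _ := True
  ten_le_size _ := le_rfl
  holds_congr _ _ _ _ _ _ := trivial

/-- The size is a bound on the names in use, not a count of them, so the new variable may be placed
in any array named `10` or higher; every array named from the size on is free as scratch space. -/
instance {V : Type} [Vars V] : Vars (V × ℕ) where
  Layout := Vars.Layout V × ℕ
  size ℓ := max (Vars.size ℓ.1) (ℓ.2 + 1)
  holds ℓ v s := 10 ≤ ℓ.2 ∧ Vars.holds ℓ.1 v.1 s ∧ s.nat ℓ.2 0 = v.2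
  ten_le_size ℓ := (Vars.ten_le_size ℓ.1).trans (le_max_left _ _)
  holds_congr ℓ v s s' h h' := by
    obtain ⟨h1, h2, h3⟩ := h
    refine ⟨h1, Vars.holds_congr _ _ _ _ h2 fun a ha ha' => h' a ha (lt_max_of_lt_left ha'), ?_⟩
    rw [h' ℓ.2 h1 (lt_max_of_lt_right (Nat.lt_succ_self _)), h3]

variable {V : Type} [Vars V]

theorem Vars.holds_of_agreeBelow {ℓ : Vars.Layout V} {v : V} {s s' : State} {d : ℕ}
    (h : Vars.holds ℓ v s) (h' : AgreeBelow d s s') (hd : Vars.size ℓ ≤ d) :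
    Vars.holds ℓ v s' :=
  Vars.holds_congr ℓ v s s' h fun a _ ha => (h' a (ha.trans_le hd)).1

/-- Some program transforms, in polynomial time, every state `s` with global memory `m` (the
arrays with names below `10`) and local variables `v` to a state `s'` with `Q m v s s'`. -/
def Computes (ℓ : Vars.Layout V) (Q : State → V → State → State → Prop) : Prop :=
  ∃ (p : Prog) (T : Polynomial ℕ), ∀ m v s, AgreeBelow 10 m s → Vars.holds ℓ v s →
    ∃ s' t, Runs p s s' t ∧ t ≤ T.eval (m.nat 0 0) ∧ Q m v s s'

variable {ℓ : Vars.Layout V} {Q Q₁ Q₂ : State → V → State → State → Prop}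

theorem Computes.mono (h : Computes ℓ Q₁)
    (hQ : ∀ m v s s', AgreeBelow 10 m s → Vars.holds ℓ v s → Q₁ m v s s' → Q m v s s') :
    Computes ℓ Q := by
  obtain ⟨p, T, h⟩ := h
  refine ⟨p, T, fun m v s hm hv => ?_⟩
  obtain ⟨s', t, h1, h2, h3⟩ := h m v s hm hv
  exact ⟨s', t, h1, h2, hQ m v s s' hm hv h3⟩

theorem computes_nstore (a : ℕ) (idx e : NExp) :
    Computes ℓ fun _ _ s s' => s' = s.setNat a (idx.eval s) (e.eval s) :=
  ⟨.nstore a idx e, Polynomial.C (idx.cost + e.cost + 1), fun _ _ s _ _ =>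
    ⟨_, _, .nstore s a idx e, by simp, rfl⟩⟩

theorem computes_rstore (a : ℕ) (idx : NExp) (e : RExp) :
    Computes ℓ fun _ _ s s' => s' = s.setReal a (idx.eval s) (e.eval s) :=
  ⟨.rstore a idx e, Polynomial.C (idx.cost + e.cost + 1), fun _ _ s _ _ =>
    ⟨_, _, .rstore s a idx e, by simp, rfl⟩⟩

/-- The condition `hagree` restores the precondition of the second program: global memory and local
variables survive the first one, which communicates only through scratch arrays. -/
theorem Computes.seq (h₁ : Computes ℓ Q₁) (h₂ : Computes ℓ Q₂)
    (hagree : ∀ m v s s', Q₁ m v s s' → AgreeBelow (Vars.size ℓ) s s')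
    (hQ : ∀ m v s s' s'', AgreeBelow 10 m s → Vars.holds ℓ v s →
      Q₁ m v s s' → Q₂ m v s' s'' → Q m v s s'') : Computes ℓ Q := by
  obtain ⟨p, T, hp⟩ := h₁
  obtain ⟨q, U, hq⟩ := h₂
  refine ⟨.seq p q, T + U, fun m v s hm hv => ?_⟩
  obtain ⟨s', t, h1, h2, h3⟩ := hp m v s hm hv
  have ha := hagree _ _ _ _ h3
  obtain ⟨s'', u, h4, h5, h6⟩ := hq m v s' (hm.trans (ha.mono (Vars.ten_le_size ℓ)))
    (Vars.holds_of_agreeBelow hv ha le_rfl)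
  exact ⟨s'', t + u, .seq h1 h4, by rw [Polynomial.eval_add]; omega, hQ _ _ _ _ _ hm hv h3 h6⟩

theorem Computes.ite (b : BExp) (h₁ : Computes ℓ Q₁) (h₂ : Computes ℓ Q₂) :
    Computes ℓ fun m v s s' => (b.eval s → Q₁ m v s s') ∧ (¬ b.eval s → Q₂ m v s s') := by
  obtain ⟨p, T, hp⟩ := h₁
  obtain ⟨q, U, hq⟩ := h₂
  refine ⟨.ite b p q, T + U + Polynomial.C (b.cost + 1), fun m v s hm hv => ?_⟩
  by_cases hb : b.eval s
  · obtain ⟨s', t, h1, h2, h3⟩ := hp m v s hm hv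
    exact ⟨s', _, .ite_true hb h1, by simp only [Polynomial.eval_add, Polynomial.eval_C]; omega,
      fun _ => h3, fun h => absurd hb h⟩
  · obtain ⟨s', t, h1, h2, h3⟩ := hq m v s hm hv
    exact ⟨s', _, .ite_false hb h1, by simp only [Polynomial.eval_add, Polynomial.eval_C]; omega,
      fun h => absurd h hb, fun _ => h3⟩

/-- `for w := 0 to n - 1 do p`, where `n` is entry `0` of the integer array `0`. -/
def Prog.forLoop (w : ℕ) (p : Prog) : Prog :=
  .seq (.nstore w (.lit 0) (.lit 0))
    (.loop (.not (.nle (.load 0 (.lit 0)) (.load w (.lit 0))))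
      (.seq p (.nstore w (.lit 0) (.add (.load w (.lit 0)) (.lit 1)))))

/-- The constants count machine steps: a round costs at most `c` for the body, `6` for the test, `6`
for the increment and `1` for control; initialisation costs `3` and the final failing test `7`. -/
theorem runs_forLoop {w : ℕ} {p : Prog} {n c : ℕ} {I : ℕ → State → Prop}
    (hn : ∀ k s, I k s → s.nat 0 0 = n) (hw : ∀ k s, I k s → s.nat w 0 = k)
    (hp : ∀ k < n, ∀ s, I k s → ∃ s' t, Runs p s s' t ∧ t ≤ c ∧
      I (k + 1) (s'.setNat w 0 (s'.nat w 0 + 1)))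
    (s : State) (hs : I 0 (s.setNat w 0 0)) :
    ∃ s' t, Runs (.forLoop w p) s s' t ∧ t ≤ n * (c + 13) + 10 ∧ I n s' := by
  -- Induction on the number `j` of rounds still to run, for all values `k` of the counter.
  suffices key : ∀ j k s, k + j = n → I k s → ∃ s' t,
      Runs (.loop (.not (.nle (.load 0 (.lit 0)) (.load w (.lit 0))))
        (.seq p (.nstore w (.lit 0) (.add (.load w (.lit 0)) (.lit 1))))) s s' t ∧
      t ≤ j * (c + 13) + 7 ∧ I n s' by
    obtain ⟨s', t, h1, h2, h3⟩ := key n 0 _ (by omega) hs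
    refine ⟨s', _, .seq (.nstore s w (.lit 0) (.lit 0)) h1, ?_, h3⟩
    simp only [NExp.cost]
    omega
  intro j
  induction j with
  | zero =>
    intro k s hk hI
    refine ⟨s, _, .loop_done ?_, ?_, ?_⟩
    · simp only [BExp.eval, NExp.eval, hn k s hI, hw k s hI]; omega
    · simp [BExp.cost, NExp.cost]
    · obtain rfl : k = n := by omega
      exact hI
  | succ j ih =>
    intro k s hk hI
    obtain ⟨s', t, h1, h2, h3⟩ := hp k (by omega) s hI
    obtain ⟨s'', u, h4, h5, h6⟩ := ih (k + 1) _ (by omega) h3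
    refine ⟨s'', _, .loop_step ?_ (.seq h1 (.nstore s' w _ _)) h4, ?_, h6⟩
    · simp only [BExp.eval, NExp.eval, hn k s hI, hw k s hI]; omega
    · simp only [BExp.cost, NExp.cost]
      rw [Nat.succ_mul]
      omega

/-- The body may change the global memory, so the invariant supplies in each round a current memory
`m'`. Only the size `m'.nat 0 0` has to stay fixed, because the time bound depends on nothing else.
-/
theorem Computes.forLoop {w : ℕ} (hw : 10 ≤ w) {Qb : State → V × ℕ → State → State → Prop}
    (hb : Computes (V := V × ℕ) (ℓ, w) Qb) (I : State → V → State → ℕ → State → Prop)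
    (h0 : ∀ m v s, AgreeBelow 10 m s → Vars.holds ℓ v s → I m v s 0 (s.setNat w 0 0))
    (hI : ∀ m v s₀ k s, I m v s₀ k s → ∃ m', AgreeBelow 10 m' s ∧ m'.nat 0 0 = m.nat 0 0 ∧
      Vars.holds ℓ v s ∧ s.nat w 0 = k ∧ ∀ s', Qb m' (v, k) s s' → k < m.nat 0 0 →
        I m v s₀ (k + 1) (s'.setNat w 0 (s'.nat w 0 + 1))) :
    Computes ℓ fun m v s s' => I m v s (m.nat 0 0) s' := by
  obtain ⟨p, T, hp⟩ := hb
  refine ⟨.forLoop w p, Polynomial.X * (T + Polynomial.C 13) + Polynomial.C 10,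
    fun m v s hm hv => ?_⟩
  simp only [Polynomial.eval_add, Polynomial.eval_mul, Polynomial.eval_X, Polynomial.eval_C]
  refine runs_forLoop (I := fun k s' => I m v s k s') ?_ ?_ ?_ s (h0 m v s hm hv)
  · intro k s' h
    obtain ⟨m', h1, h2, h3, h4, -⟩ := hI _ _ _ _ _ h
    rw [(h1 0 (by omega)).1, h2]
  · intro k s' h
    obtain ⟨m', h1, h2, h3, h4, -⟩ := hI _ _ _ _ _ h
    exact h4
  · intro k hk s' h
    obtain ⟨m', h1, h2, h3, h4, h5⟩ := hI _ _ _ _ _ h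
    obtain ⟨s'', t, h6, h7, h8⟩ := hp m' (v, k) s' h1 ⟨hw, h3, h4⟩
    exact ⟨s'', t, h6, by rwa [h2] at h7, h5 _ h8 hk⟩

/-- The natural number `f m v` can be computed in polynomial time, into any array that is not
in use. -/
def NatPoly (f : State → V → ℕ) : Prop :=
  ∀ (ℓ : Vars.Layout V) (d : ℕ), Vars.size ℓ ≤ d →
    Computes ℓ fun m v s s' => s'.nat d 0 = f m v ∧ AgreeBelow d s s'

/-- The real number `f m v` can be computed in polynomial time, into any array that is not
in use. -/
def RealPoly (f : State → V → ℝ) : Prop :=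
  ∀ (ℓ : Vars.Layout V) (d : ℕ), Vars.size ℓ ≤ d →
    Computes ℓ fun m v s s' => s'.real d 0 = f m v ∧ AgreeBelow d s s'

open Classical in
/-- The proposition `P m v` can be decided in polynomial time. -/
def PropPoly (P : State → V → Prop) : Prop :=
  NatPoly fun m v => if P m v then 1 else 0

section closure

variable {f g : State → V → ℕ} {u w : State → V → ℝ} {P R : State → V → Prop}

theorem NatPoly.const (k : ℕ) : NatPoly fun _ (_ : V) => k := fun _ d _ =>
  (computes_nstore d (.lit 0) (.lit k)).mono fun _ _ s _ _ _ h => by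
    subst h
    exact ⟨by simp [NExp.eval], agreeBelow_setNat le_rfl s _ _⟩

theorem NatPoly.var : NatPoly fun _ (v : V × ℕ) => v.2 := fun ℓ d _ =>
  (computes_nstore d (.lit 0) (.load ℓ.2 (.lit 0))).mono fun _ _ s _ _ hv h => by
    subst h
    exact ⟨by simp [NExp.eval, hv.2.2], agreeBelow_setNat le_rfl s _ _⟩

theorem Computes.weaken {n : ℕ} (h : Computes ℓ Q) :
    Computes (V := V × ℕ) (ℓ, n) fun m v s s' => Q m v.1 s s' := by
  obtain ⟨p, T, h⟩ := h
  exact ⟨p, T, fun m v s hm hv => h m v.1 s hm hv.2.1⟩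

theorem NatPoly.weaken (hf : NatPoly f) : NatPoly fun m (v : V × ℕ) => f m v.1 :=
  fun ℓ d hd => (hf ℓ.1 d ((le_max_left _ _).trans hd)).weaken

/-- Needed for a quantifier nested in a search: the predicate sees the innermost variable and the
outer context, but not the search variable in between. -/
theorem NatPoly.weakenMiddle {f : State → V × ℕ → ℕ} (hf : NatPoly f) :
    NatPoly fun m (v : (V × ℕ) × ℕ) => f m (v.1.1, v.2) := fun ℓ d hd => by
  have hd' : max (max (Vars.size ℓ.1.1) (ℓ.1.2 + 1)) (ℓ.2 + 1) ≤ d := hd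
  obtain ⟨p, T, h⟩ := hf (ℓ.1.1, ℓ.2) d (by change max _ _ ≤ d; simp only [max_le_iff] at *; omega)
  exact ⟨p, T, fun m v s hm hv => h m (v.1.1, v.2) s hm ⟨hv.1, hv.2.1.2.1, hv.2.2⟩⟩

theorem NatPoly.load {a : ℕ} (ha : a < 10) (hf : NatPoly f) :
    NatPoly fun m v => m.nat a (f m v) := fun ℓ d hd =>
  (hf ℓ d hd).seq (computes_nstore d (.lit 0) (.load a (.load d (.lit 0))))
    (fun _ _ _ _ h => h.2.mono hd) fun m v s s' s'' hm _ h h' => by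
      subst h'
      refine ⟨?_, h.2.trans (agreeBelow_setNat le_rfl s' _ _)⟩
      have := Vars.ten_le_size ℓ
      simp [NExp.eval, h.1, (h.2 a (by omega)).1, (hm a ha).1]

theorem RealPoly.load {a : ℕ} (ha : a < 10) (hf : NatPoly f) :
    RealPoly fun m v => m.real a (f m v) := fun ℓ d hd =>
  (hf ℓ d hd).seq (computes_rstore d (.lit 0) (.load a (.load d (.lit 0))))
    (fun _ _ _ _ h => h.2.mono hd) fun m v s s' s'' hm _ h h' => by
      subst h'
      refine ⟨?_, h.2.trans (agreeBelow_setReal le_rfl s' _ _)⟩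
      have := Vars.ten_le_size ℓ
      simp [NExp.eval, RExp.eval, h.1, (h.2 a (by omega)).2, (hm a ha).2]

theorem RealPoly.const (k : ℕ) : RealPoly fun _ (_ : V) => (k : ℝ) := fun _ d _ =>
  (computes_rstore d (.lit 0) (.lit k)).mono fun _ _ s _ _ _ h => by
    subst h
    exact ⟨by simp [NExp.eval, RExp.eval], agreeBelow_setReal le_rfl s _ _⟩

/-- The second value goes to the array `d + 1`, so its computation leaves the first value, in the
array `d`, intact. -/
theorem NatPoly.pair (hf : NatPoly f) (hg : NatPoly g) (ℓ : Vars.Layout V) (d : ℕ)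
    (hd : Vars.size ℓ ≤ d) :
    Computes ℓ fun m v s s' => s'.nat d 0 = f m v ∧ s'.nat (d + 1) 0 = g m v ∧
      AgreeBelow d s s' :=
  (hf ℓ d hd).seq (hg ℓ (d + 1) (by omega)) (fun _ _ _ _ h => h.2.mono hd)
    fun _ _ _ _ _ _ _ h h' => ⟨by rw [(h'.2 d (by omega)).1, h.1], h'.1,
      h.2.trans (h'.2.mono (by omega))⟩

theorem RealPoly.pair (hf : RealPoly u) (hg : RealPoly w) (ℓ : Vars.Layout V) (d : ℕ)
    (hd : Vars.size ℓ ≤ d) :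
    Computes ℓ fun m v s s' => s'.real d 0 = u m v ∧ s'.real (d + 1) 0 = w m v ∧
      AgreeBelow d s s' :=
  (hf ℓ d hd).seq (hg ℓ (d + 1) (by omega)) (fun _ _ _ _ h => h.2.mono hd)
    fun _ _ _ _ _ _ _ h h' => ⟨by rw [(h'.2 d (by omega)).2, h.1], h'.1,
      h.2.trans (h'.2.mono (by omega))⟩

theorem NatPoly.map₂ (op : ℕ → ℕ → ℕ) (mk : NExp → NExp → NExp)
    (hmk : ∀ s e e', (mk e e').eval s = op (e.eval s) (e'.eval s))
    (hf : NatPoly f) (hg : NatPoly g) : NatPoly fun m v => op (f m v) (g m v) := fun ℓ d hd =>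
  (hf.pair hg ℓ d hd).seq
    (computes_nstore d (.lit 0) (mk (.load d (.lit 0)) (.load (d + 1) (.lit 0))))
    (fun _ _ _ _ h => h.2.2.mono hd) fun m v s s' s'' hm _ h h' => by
      subst h'
      refine ⟨?_, h.2.2.trans (agreeBelow_setNat le_rfl s' _ _)⟩
      simp [NExp.eval, hmk, h.1, h.2.1]

theorem RealPoly.map₂ (op : ℝ → ℝ → ℝ) (mk : RExp → RExp → RExp)
    (hmk : ∀ s e e', (mk e e').eval s = op (e.eval s) (e'.eval s))
    (hf : RealPoly u) (hg : RealPoly w) : RealPoly fun m v => op (u m v) (w m v) := fun ℓ d hd =>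
  (hf.pair hg ℓ d hd).seq
    (computes_rstore d (.lit 0) (mk (.load d (.lit 0)) (.load (d + 1) (.lit 0))))
    (fun _ _ _ _ h => h.2.2.mono hd) fun m v s s' s'' hm _ h h' => by
      subst h'
      refine ⟨?_, h.2.2.trans (agreeBelow_setReal le_rfl s' _ _)⟩
      simp [NExp.eval, RExp.eval, hmk, h.1, h.2.1]

theorem NatPoly.add (hf : NatPoly f) (hg : NatPoly g) : NatPoly fun m v => f m v + g m v :=
  hf.map₂ (· + ·) .add (fun _ _ _ => rfl) hg

theorem NatPoly.sub (hf : NatPoly f) (hg : NatPoly g) : NatPoly fun m v => f m v - g m v :=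
  hf.map₂ (· - ·) .sub (fun _ _ _ => rfl) hg

theorem RealPoly.add (hf : RealPoly u) (hg : RealPoly w) : RealPoly fun m v => u m v + w m v :=
  hf.map₂ (· + ·) .add (fun _ _ _ => rfl) hg

theorem RealPoly.sub (hf : RealPoly u) (hg : RealPoly w) : RealPoly fun m v => u m v - w m v :=
  hf.map₂ (· - ·) .sub (fun _ _ _ => rfl) hg

theorem RealPoly.mul (hf : RealPoly u) (hg : RealPoly w) : RealPoly fun m v => u m v * w m v :=
  hf.map₂ (· * ·) .mul (fun _ _ _ => rfl) hg

open Classical in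
theorem propPoly_of_test (b : BExp) (d : ℕ) (hd : Vars.size ℓ ≤ d)
    (hQ : Computes ℓ Q) (hb : ∀ m v s s', Q m v s s' → (b.eval s' ↔ P m v))
    (ha : ∀ m v s s', Q m v s s' → AgreeBelow d s s') :
    Computes ℓ fun m v s s' =>
      s'.nat d 0 = (if P m v then 1 else 0) ∧ AgreeBelow d s s' :=
  hQ.seq (.ite b (computes_nstore d (.lit 0) (.lit 1)) (computes_nstore d (.lit 0) (.lit 0)))
    (fun _ _ _ _ h => (ha _ _ _ _ h).mono hd) fun m v s s' s'' _ _ h h' => by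
      by_cases hP : P m v
      · have h1 := h'.1 ((hb _ _ _ _ h).2 hP)
        subst h1
        exact ⟨by simp [NExp.eval, hP], (ha _ _ _ _ h).trans (agreeBelow_setNat le_rfl _ _ _)⟩
      · have h1 := h'.2 fun hbs => hP ((hb _ _ _ _ h).1 hbs)
        subst h1
        exact ⟨by simp [NExp.eval, hP], (ha _ _ _ _ h).trans (agreeBelow_setNat le_rfl _ _ _)⟩

theorem NatPoly.le (hf : NatPoly f) (hg : NatPoly g) : PropPoly fun m v => f m v ≤ g m v :=
  fun ℓ d hd => propPoly_of_test (.nle (.load d (.lit 0)) (.load (d + 1) (.lit 0))) d hd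
    (hf.pair hg ℓ d hd) (fun _ _ _ _ h => by simp [BExp.eval, NExp.eval, h.1, h.2.1])
    fun _ _ _ _ h => h.2.2

theorem RealPoly.le (hf : RealPoly u) (hg : RealPoly w) : PropPoly fun m v => u m v ≤ w m v :=
  fun ℓ d hd => propPoly_of_test (.rle (.load d (.lit 0)) (.load (d + 1) (.lit 0))) d hd
    (hf.pair hg ℓ d hd) (fun _ _ _ _ h => by simp [BExp.eval, NExp.eval, RExp.eval, h.1, h.2.1])
    fun _ _ _ _ h => h.2.2

theorem PropPoly.congr (hP : PropPoly P) (h : ∀ m v, P m v ↔ R m v) : PropPoly R := by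
  rwa [show R = P from funext₂ fun m v => propext (h m v).symm]

theorem PropPoly.not (hP : PropPoly P) : PropPoly fun m v => ¬ P m v :=
  (NatPoly.le hP (.const 0)).congr fun m v => by split_ifs <;> simp_all

theorem PropPoly.or (hP : PropPoly P) (hR : PropPoly R) : PropPoly fun m v => P m v ∨ R m v :=
  (NatPoly.le (.const 1) (NatPoly.add hP hR)).congr fun m v => by
    by_cases h : P m v <;> by_cases h' : R m v <;> simp [h, h']

theorem PropPoly.and (hP : PropPoly P) (hR : PropPoly R) : PropPoly fun m v => P m v ∧ R m v :=
  (hP.not.or hR.not).not.congr fun m v => by tauto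

theorem PropPoly.imp (hP : PropPoly P) (hR : PropPoly R) : PropPoly fun m v => P m v → R m v :=
  (hP.not.or hR).congr fun m v => by tauto

theorem NatPoly.lt (hf : NatPoly f) (hg : NatPoly g) : PropPoly fun m v => f m v < g m v :=
  (hg.le hf).not.congr fun m v => by simp

theorem NatPoly.eq (hf : NatPoly f) (hg : NatPoly g) : PropPoly fun m v => f m v = g m v :=
  ((hf.le hg).and (hg.le hf)).congr fun m v => by simp [le_antisymm_iff]

theorem RealPoly.lt (hf : RealPoly u) (hg : RealPoly w) : PropPoly fun m v => u m v < w m v :=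
  (hg.le hf).not.congr fun m v => by simp

theorem RealPoly.eq (hf : RealPoly u) (hg : RealPoly w) : PropPoly fun m v => u m v = w m v :=
  ((hf.le hg).and (hg.le hf)).congr fun m v => by simp [le_antisymm_iff]

theorem NatPoly.ite {_ : ∀ m v, Decidable (P m v)} (hP : PropPoly P) (hf : NatPoly f) (hg : NatPoly g) :
    NatPoly fun m v => if P m v then f m v else g m v := fun ℓ d hd =>
  (hP ℓ d hd).seq (.ite (.nle (.lit 1) (.load d (.lit 0))) (hf ℓ d hd) (hg ℓ d hd))
    (fun _ _ _ _ h => h.2.mono hd) fun m v s s' s'' _ _ h h' => by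
      by_cases hp : P m v
      · have h1 := h'.1 (by simp [BExp.eval, NExp.eval, h.1, hp])
        exact ⟨by simp [h1.1, hp], h.2.trans h1.2⟩
      · have h1 := h'.2 (by simp [BExp.eval, NExp.eval, h.1, hp])
        exact ⟨by simp [h1.1, hp], h.2.trans h1.2⟩

theorem RealPoly.ite {_ : ∀ m v, Decidable (P m v)} (hP : PropPoly P) (hf : RealPoly u) (hg : RealPoly w) :
    RealPoly fun m v => if P m v then u m v else w m v := fun ℓ d hd =>
  (hP ℓ d hd).seq (.ite (.nle (.lit 1) (.load d (.lit 0))) (hf ℓ d hd) (hg ℓ d hd))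
    (fun _ _ _ _ h => h.2.mono hd) fun m v s s' s'' _ _ h h' => by
      by_cases hp : P m v
      · have h1 := h'.1 (by simp [BExp.eval, NExp.eval, h.1, hp])
        exact ⟨by simp [h1.1, hp], h.2.trans h1.2⟩
      · have h1 := h'.2 (by simp [BExp.eval, NExp.eval, h.1, hp])
        exact ⟨by simp [h1.1, hp], h.2.trans h1.2⟩

/-- The accumulator is in the array `d`, the loop counter in `d + 1`, and each summand is computed
into `d + 2`. Bounded quantifiers and counting are sums of indicators, so all of them rest on this
loop. -/
theorem NatPoly.sum {f : State → V → ℕ → ℕ} (hf : NatPoly fun m (v : V × ℕ) => f m v.1 v.2) :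
    NatPoly fun m v => ∑ k ∈ Finset.range (m.nat 0 0), f m v k := fun ℓ d hd => by
  have h10 := Vars.ten_le_size ℓ
  have hbody := (hf (ℓ, d + 1) (d + 2) (by change max _ _ ≤ _; simp; omega)).seq
    (Q := fun m v s s' => s'.nat d 0 = s.nat d 0 + f m v.1 v.2 ∧
      s'.nat (d + 1) 0 = s.nat (d + 1) 0 ∧ AgreeBelow d s s')
    (computes_nstore d (.lit 0) (.add (.load d (.lit 0)) (.load (d + 2) (.lit 0))))
    (fun _ _ _ _ h => h.2.mono (by change max _ _ ≤ _; simp; omega))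
    (fun m v s s' s'' _ _ h h' => by
      subst h'
      refine ⟨?_, ?_, (h.2.mono (by omega)).trans (agreeBelow_setNat le_rfl _ _ _)⟩
      · simp [NExp.eval, h.1, (h.2 d (by omega)).1]
      · simp [(h.2 (d + 1) (by omega)).1])
  refine ((computes_nstore d (.lit 0) (.lit 0)).seq (hbody.forLoop (by omega)
    (fun m v s₀ k s => AgreeBelow d s₀ s ∧ AgreeBelow 10 m s ∧ Vars.holds ℓ v s ∧
      s.nat (d + 1) 0 = k ∧ s.nat d 0 = s₀.nat d 0 + ∑ i ∈ Finset.range k, f m v i) ?_ ?_) ?_ ?_)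
  · intro m v s hm hv
    have := agreeBelow_setNat (d := d) (a := d + 1) (by omega) s 0 0
    exact ⟨this, hm.trans (this.mono (by omega)), Vars.holds_of_agreeBelow hv this hd,
      by simp, by simp⟩
  · rintro m v s₀ k s ⟨h1, h2, h3, h4, h5⟩
    refine ⟨m, h2, rfl, h3, h4, fun s' h hk => ?_⟩
    have := h.2.2.trans (agreeBelow_setNat (a := d + 1) (by omega) s' 0 (s'.nat (d + 1) 0 + 1))
    refine ⟨h1.trans this, h2.trans (this.mono (by omega)),
      Vars.holds_of_agreeBelow h3 this hd, ?_, ?_⟩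
    · simp [h.2.1, h4]
    · simp [h.1, h5, Finset.sum_range_succ, add_assoc]
  · rintro m v s s' rfl
    exact agreeBelow_setNat hd _ _ _
  · rintro m v s s' s'' hm hv rfl ⟨h1, h2, h3, h4, h5⟩
    exact ⟨by simpa [NExp.eval] using h5, (agreeBelow_setNat le_rfl _ _ _).trans h1⟩

theorem RealPoly.sum {f : State → V → ℕ → ℝ}
    (hf : RealPoly fun m (v : V × ℕ) => f m v.1 v.2) :
    RealPoly fun m v => ∑ k ∈ Finset.range (m.nat 0 0), f m v k := fun ℓ d hd => by
  have h10 := Vars.ten_le_size ℓ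
  have hbody := (hf (ℓ, d + 1) (d + 2) (by change max _ _ ≤ _; simp; omega)).seq
    (Q := fun m v s s' => s'.real d 0 = s.real d 0 + f m v.1 v.2 ∧
      s'.nat (d + 1) 0 = s.nat (d + 1) 0 ∧ AgreeBelow d s s')
    (computes_rstore d (.lit 0) (.add (.load d (.lit 0)) (.load (d + 2) (.lit 0))))
    (fun _ _ _ _ h => h.2.mono (by change max _ _ ≤ _; simp; omega))
    (fun m v s s' s'' _ _ h h' => by
      subst h'
      refine ⟨?_, ?_, (h.2.mono (by omega)).trans (agreeBelow_setReal le_rfl _ _ _)⟩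
      · simp [NExp.eval, RExp.eval, h.1, (h.2 d (by omega)).2]
      · simp [(h.2 (d + 1) (by omega)).1])
  refine ((computes_rstore d (.lit 0) (.lit 0)).seq (hbody.forLoop (by omega)
    (fun m v s₀ k s => AgreeBelow d s₀ s ∧ AgreeBelow 10 m s ∧ Vars.holds ℓ v s ∧
      s.nat (d + 1) 0 = k ∧ s.real d 0 = s₀.real d 0 + ∑ i ∈ Finset.range k, f m v i) ?_ ?_) ?_ ?_)
  · intro m v s hm hv
    have := agreeBelow_setNat (d := d) (a := d + 1) (by omega) s 0 0
    exact ⟨this, hm.trans (this.mono (by omega)), Vars.holds_of_agreeBelow hv this hd,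
      by simp, by simp⟩
  · rintro m v s₀ k s ⟨h1, h2, h3, h4, h5⟩
    refine ⟨m, h2, rfl, h3, h4, fun s' h hk => ?_⟩
    have := h.2.2.trans (agreeBelow_setNat (a := d + 1) (by omega) s' 0 (s'.nat (d + 1) 0 + 1))
    refine ⟨h1.trans this, h2.trans (this.mono (by omega)),
      Vars.holds_of_agreeBelow h3 this hd, ?_, ?_⟩
    · simp [h.2.1, h4]
    · simp [h.1, h5, Finset.sum_range_succ, add_assoc]
  · rintro m v s s' rfl
    exact agreeBelow_setReal hd _ _ _
  · rintro m v s s' s'' hm hv rfl ⟨h1, h2, h3, h4, h5⟩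
    exact ⟨by simpa [NExp.eval, RExp.eval] using h5, (agreeBelow_setReal le_rfl _ _ _).trans h1⟩

theorem PropPoly.ex {P : State → V → ℕ → Prop} (hP : PropPoly fun m (v : V × ℕ) => P m v.1 v.2) :
    PropPoly fun m v => ∃ k < m.nat 0 0, P m v k := by
  classical
  exact (NatPoly.lt (.const 0) (NatPoly.sum (f := fun m v k => if P m v k then 1 else 0) hP)).congr
    fun m v => by simp [Finset.Nonempty]

theorem PropPoly.all {P : State → V → ℕ → Prop} (hP : PropPoly fun m (v : V × ℕ) => P m v.1 v.2) :
    PropPoly fun m v => ∀ k < m.nat 0 0, P m v k :=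
  (PropPoly.ex (P := fun m v k => ¬ P m v k) hP.not).not.congr fun m v => by simp

theorem NatPoly.card {P : State → V → ℕ → Prop} {_ : ∀ m v, DecidablePred (P m v)}
    (hP : PropPoly fun m (v : V × ℕ) => P m v.1 v.2) :
    NatPoly fun m v => ((Finset.range (m.nat 0 0)).filter (P m v)).card := by
  classical
  convert NatPoly.sum (f := fun m v k => if P m v k then 1 else 0)
    (by unfold PropPoly at hP; convert hP) using 3
  exact Finset.card_filter _ _

theorem NatPoly.size : NatPoly fun m (_ : V) => m.nat 0 0 := .load (by omega) (.const 0)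

/-- Naturals cannot be multiplied in one step; the product with `n` is a sum of `n` equal terms. -/
theorem NatPoly.mulSize (hf : NatPoly f) : NatPoly fun m v => f m v * m.nat 0 0 := by
  have := NatPoly.sum (f := fun m v _ => f m v) hf.weaken
  simpa [mul_comm] using this

end closure

/-! ### Polynomial-time transformations of the global memory -/

/-- The global memory can be transformed to `f m v` in polynomial time. -/
def CmdPoly (f : State → V → State) : Prop :=
  ∀ (ℓ : Vars.Layout V) (d : ℕ), Vars.size ℓ ≤ d →
    Computes ℓ fun m v s s' => AgreeBelow 10 (f m v) s' ∧
      ∀ a, 10 ≤ a → a < d → s'.nat a = s.nat a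

/-- `for k := 0 to n - 1 do f`, as a function on memory states. -/
def State.iterate (f : State → ℕ → State) (m : State) (n : ℕ) : State :=
  n.rec m fun k m' => f m' k

theorem CmdPoly.store {a : ℕ} (ha : a < 10) {i e : State → V → ℕ} (hi : NatPoly i)
    (he : NatPoly e) : CmdPoly fun m v => m.setNat a (i m v) (e m v) := fun ℓ d hd =>
  (hi.pair he ℓ d hd).seq (computes_nstore a (.load d (.lit 0)) (.load (d + 1) (.lit 0)))
    (fun _ _ _ _ h => h.2.2.mono hd) fun m v s s' s'' hm _ h h' => by
      subst h'
      have h10 := Vars.ten_le_size ℓ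
      have hs := hm.trans (h.2.2.mono (by omega))
      refine ⟨fun b hb => ?_, fun b hb hb' => ?_⟩
      · refine ⟨?_, by simpa using (hs b hb).2⟩
        simp only [State.setNat_nat, NExp.eval, h.1, h.2.1]
        by_cases hba : b = a
        · subst hba
          simp [(hs b hb).1]
        · simp [Function.update_of_ne hba, (hs b hb).1]
      · simp [Function.update_of_ne (show b ≠ a by omega), (h.2.2 b (by omega)).1]

/-- By `hn` both time bounds are evaluated at the same size, so they add up instead of being
composed. -/
theorem CmdPoly.seq {f g : State → V → State} (hf : CmdPoly f) (hg : CmdPoly g)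
    (hn : ∀ m v, (f m v).nat 0 0 = m.nat 0 0) : CmdPoly fun m v => g (f m v) v := by
  intro ℓ d hd
  obtain ⟨p, T, hp⟩ := hf ℓ d hd
  obtain ⟨q, U, hq⟩ := hg ℓ d hd
  refine ⟨.seq p q, T + U, fun m v s hm hv => ?_⟩
  obtain ⟨s', t, h1, h2, h3, h4⟩ := hp m v s hm hv
  obtain ⟨s'', u, h5, h6, h7, h8⟩ := hq (f m v) v s' h3
    (Vars.holds_congr _ _ _ _ hv fun a ha ha' => h4 a ha (by omega))
  refine ⟨s'', t + u, .seq h1 h5, ?_, h7, fun a ha ha' => (h8 a ha ha').trans (h4 a ha ha')⟩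
  rw [hn] at h6
  rw [Polynomial.eval_add]
  omega

theorem CmdPoly.forLoop {f : State → V × ℕ → State} (hf : CmdPoly f)
    (hn : ∀ m v, (f m v).nat 0 0 = m.nat 0 0) :
    CmdPoly fun m v => State.iterate (fun m' k => f m' (v, k)) m (m.nat 0 0) := by
  intro ℓ d hd
  have h10 := Vars.ten_le_size ℓ
  refine (Computes.forLoop (w := d) (by omega) (hf (ℓ, d) (d + 1) (by change max _ _ ≤ _; simp; omega))
    (fun m v s₀ k s => AgreeBelow 10 (State.iterate (fun m' k => f m' (v, k)) m k) s ∧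
      (∀ a, 10 ≤ a → a < d → s.nat a = s₀.nat a) ∧ Vars.holds ℓ v s ∧ s.nat d 0 = k) ?_ ?_).mono
    fun m v s s' _ _ h => ⟨h.1, h.2.1⟩
  · intro m v s hm hv
    have := agreeBelow_setNat (d := d) (a := d) le_rfl s 0 0
    exact ⟨hm.trans (this.mono (by omega)), fun a _ ha => (this a ha).1,
      Vars.holds_of_agreeBelow hv this hd, by simp⟩
  · rintro m v s₀ k s ⟨h1, h2, h3, h4⟩
    refine ⟨_, h1, ?_, h3, h4, fun s' h _ => ?_⟩
    · clear h1 h4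
      induction k with
      | zero => rfl
      | succ k ih => exact (hn _ _).trans ih
    · have := agreeBelow_setNat (d := d) (a := d) le_rfl s' 0 (s'.nat d 0 + 1)
      have h' : ∀ a, 10 ≤ a → a < d →
          (s'.setNat d 0 (s'.nat d 0 + 1)).nat a = s.nat a := fun a ha ha' => by
        rw [(this a ha').1, h.2 a ha (by omega)]
      refine ⟨h.1.trans (this.mono (by omega)), fun a ha ha' => (h' a ha ha').trans (h2 a ha ha'),
        Vars.holds_congr _ _ _ _ h3 fun a ha ha' => h' a ha (by omega), ?_⟩
      simp [h.2 d (by omega) (by omega), h4]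

end RealRAM

/-! ### The tests of the algorithm and their complexity -/

namespace RealRAM

/-- The square of the distance of the centres of the disks `i` and `j`. -/
noncomputable def sqDist (m : State) (i j : ℕ) : ℝ :=
  (m.real 0 i - m.real 0 j) * (m.real 0 i - m.real 0 j) +
    (m.real 1 i - m.real 1 j) * (m.real 1 i - m.real 1 j)

/-- The centre of the disk `k` is lexicographically smaller than that of `i`. -/
def LexLeft (m : State) (k i : ℕ) : Prop :=
  m.real 0 k < m.real 0 i ∨ m.real 0 k = m.real 0 i ∧ m.real 1 k < m.real 1 i

/-- `Disk.Precedes`, in terms of the memory. -/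
def Before (m : State) (i k j : ℕ) : Prop :=
  k ≠ i ∧ j ≠ i ∧ (sqDist m i k < sqDist m i j ∨ sqDist m i k = sqDist m i j ∧ k < j)

/-- The disk `k` is `i`, or `j`, or one of the disks preceding `j` in the sequence of `i`. -/
def InGroup (m : State) (i j k : ℕ) : Prop :=
  k = i ∨ k = j ∨ Before m i k j

open Classical in
/-- `Disk.radiusBefore`, in terms of the memory. -/
noncomputable def radiusUpTo (m : State) (i j : ℕ) : ℝ :=
  m.real 2 i + ∑ k ∈ Finset.range (m.nat 0 0), if Before m i k j then m.real 2 k else (0 : ℕ)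

open Classical in
/-- The sum of the radii in the group `(i, j)`. -/
noncomputable def groupRadius (m : State) (i j : ℕ) : ℝ :=
  ∑ k ∈ Finset.range (m.nat 0 0), if InGroup m i j k then m.real 2 k else (0 : ℕ)

/-- The group `(i, j)` can be merged with `i`, and contains all or none of any disks with the same
centre. -/
def ValidGroup (m : State) (i j : ℕ) : Prop :=
  (∀ k < m.nat 0 0, InGroup m i j k → k = i ∨ sqDist m i k < radiusUpTo m i k * radiusUpTo m i k) ∧
    ∀ k < m.nat 0 0, ∀ k' < m.nat 0 0, InGroup m i j k → ¬ LexLeft m k k' ∧ ¬ LexLeft m k' k →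
      InGroup m i j k'

open Classical in
/-- The number of disks to the left of the group `(i, j)`. -/
noncomputable def groupStart (m : State) (i j : ℕ) : ℕ :=
  ((Finset.range (m.nat 0 0)).filter fun k => LexLeft m k i ∧ ¬ InGroup m i j k).card

open Classical in
/-- The number of disks in the group `(i, j)` or to the left of it. -/
noncomputable def groupEnd (m : State) (i j : ℕ) : ℕ :=
  ((Finset.range (m.nat 0 0)).filter fun k => LexLeft m k i ∨ InGroup m i j k).card

/-- The group `(i', j')` may directly follow the group `(i, j)`. -/
def Compatible (m : State) (i j i' j' : ℕ) : Prop :=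
  groupEnd m i j = groupStart m i' j' ∧
    groupRadius m i j * groupRadius m i j ≤ sqDist m i i' ∧
    groupRadius m i' j' * groupRadius m i' j' ≤ sqDist m i i'

/-- The address of the entry `(l, i, j)` of a table. -/
def address (n l i j : ℕ) : ℕ := (l * n + i) * n + j

/-- The entry `(l, i, j)` of the table, in terms of the previous entries. -/
def LayerTest (m : State) (l i j : ℕ) : Prop :=
  ValidGroup m i j ∧ (l = 0 ∧ groupEnd m i j = m.nat 0 0 ∨
    l ≠ 0 ∧ ∃ i' < m.nat 0 0, ∃ j' < m.nat 0 0,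
      m.nat 2 (address (m.nat 0 0) (l - 1) i' j') = 1 ∧ Compatible m i j i' j')

open Classical in
/-- The least number below `n` that satisfies `P`, if there is one. -/
noncomputable def leastBelow (n : ℕ) (P : ℕ → Prop) : ℕ :=
  ((Finset.range n).filter fun k => ∀ k' < n, k' ≤ k → ¬ P k').card

open Classical in
/-- One more than the greatest number below `n` that satisfies `P`, or `0` if there is none. -/
noncomputable def greatestSucc (n : ℕ) (P : ℕ → Prop) : ℕ :=
  ((Finset.range n).filter fun k => ∃ k' < n, k ≤ k' ∧ P k').card

/-- Some sequence of `l + 1` groups that covers all disks starts with the group `(i, j)`. -/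
def StartTest (m : State) (l : ℕ) : Prop :=
  ∃ i < m.nat 0 0, ∃ j < m.nat 0 0,
    m.nat 2 (address (m.nat 0 0) l i j) = 1 ∧ groupStart m i j = 0

/-- The group `(i, j)` can be the one number `q` in a longest sequence. -/
def ChoiceTest (m : State) (q i j : ℕ) : Prop :=
  m.nat 2 (address (m.nat 0 0) (m.nat 3 0 - 1 - q) i j) = 1 ∧ (q = 0 → groupStart m i j = 0) ∧
    (q ≠ 0 → Compatible m (m.nat 4 (q - 1)) (m.nat 5 (q - 1)) i j)

section closure

variable {V : Type} [Vars V] {i j k l i' j' : State → V → ℕ}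

theorem RealPoly.sqDist (hi : NatPoly i) (hj : NatPoly j) :
    RealPoly fun m v => sqDist m (i m v) (j m v) := by
  have h : ∀ a < 10, RealPoly fun m v => m.real a (i m v) - m.real a (j m v) :=
    fun a ha => (RealPoly.load ha hi).sub (RealPoly.load ha hj)
  exact ((h 0 (by omega)).mul (h 0 (by omega))).add ((h 1 (by omega)).mul (h 1 (by omega)))

theorem PropPoly.lexLeft (hi : NatPoly i) (hj : NatPoly j) :
    PropPoly fun m v => LexLeft m (i m v) (j m v) := by
  have h : ∀ a < 10, PropPoly fun m v => m.real a (i m v) < m.real a (j m v) :=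
    fun a ha => (RealPoly.load ha hi).lt (RealPoly.load ha hj)
  exact (h 0 (by omega)).or
    (((RealPoly.load (by omega) hi).eq (RealPoly.load (by omega) hj)).and (h 1 (by omega)))

theorem PropPoly.before (hi : NatPoly i) (hk : NatPoly k) (hj : NatPoly j) :
    PropPoly fun m v => Before m (i m v) (k m v) (j m v) :=
  (hk.eq hi).not.and ((hj.eq hi).not.and (((RealPoly.sqDist hi hk).lt (RealPoly.sqDist hi hj)).or
    (((RealPoly.sqDist hi hk).eq (RealPoly.sqDist hi hj)).and (hk.lt hj))))

theorem PropPoly.inGroup (hi : NatPoly i) (hj : NatPoly j) (hk : NatPoly k) :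
    PropPoly fun m v => InGroup m (i m v) (j m v) (k m v) :=
  (hk.eq hi).or ((hk.eq hj).or (.before hi hk hj))

theorem RealPoly.radiusUpTo (hi : NatPoly i) (hj : NatPoly j) :
    RealPoly fun m v => radiusUpTo m (i m v) (j m v) :=
  (RealPoly.load (by omega) hi).add (RealPoly.sum
    (.ite (.before hi.weaken .var hj.weaken) (.load (by omega) .var) (.const 0)))

theorem RealPoly.groupRadius (hi : NatPoly i) (hj : NatPoly j) :
    RealPoly fun m v => groupRadius m (i m v) (j m v) :=
  RealPoly.sum (.ite (.inGroup hi.weaken hj.weaken .var) (.load (by omega) .var) (.const 0))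

theorem PropPoly.validGroup (hi : NatPoly i) (hj : NatPoly j) :
    PropPoly fun m v => ValidGroup m (i m v) (j m v) :=
  (PropPoly.all ((PropPoly.inGroup hi.weaken hj.weaken .var).imp ((NatPoly.var.eq hi.weaken).or
    ((RealPoly.sqDist hi.weaken .var).lt ((RealPoly.radiusUpTo hi.weaken .var).mul
      (.radiusUpTo hi.weaken .var)))))).and
  (PropPoly.all (PropPoly.all ((PropPoly.inGroup hi.weaken.weaken hj.weaken.weaken
    (NatPoly.var (V := V)).weaken).imp
      (((PropPoly.lexLeft (NatPoly.var (V := V)).weaken .var).not.and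
        (PropPoly.lexLeft .var (NatPoly.var (V := V)).weaken).not).imp
      (.inGroup hi.weaken.weaken hj.weaken.weaken .var)))))

theorem NatPoly.groupStart (hi : NatPoly i) (hj : NatPoly j) :
    NatPoly fun m v => groupStart m (i m v) (j m v) :=
  NatPoly.card ((PropPoly.lexLeft .var hi.weaken).and
    (PropPoly.inGroup hi.weaken hj.weaken .var).not)

theorem NatPoly.groupEnd (hi : NatPoly i) (hj : NatPoly j) :
    NatPoly fun m v => groupEnd m (i m v) (j m v) :=
  NatPoly.card ((PropPoly.lexLeft .var hi.weaken).or (.inGroup hi.weaken hj.weaken .var))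

theorem PropPoly.compatible (hi : NatPoly i) (hj : NatPoly j) (hi' : NatPoly i')
    (hj' : NatPoly j') :
    PropPoly fun m v => Compatible m (i m v) (j m v) (i' m v) (j' m v) :=
  ((NatPoly.groupEnd hi hj).eq (.groupStart hi' hj')).and
    ((((RealPoly.groupRadius hi hj).mul (.groupRadius hi hj)).le (.sqDist hi hi')).and
      (((RealPoly.groupRadius hi' hj').mul (.groupRadius hi' hj')).le (.sqDist hi hi')))

theorem NatPoly.address (hl : NatPoly l) (hi : NatPoly i) (hj : NatPoly j) :
    NatPoly fun m v => address (m.nat 0 0) (l m v) (i m v) (j m v) :=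
  (hl.mulSize.add hi).mulSize.add hj

theorem PropPoly.layerTest (hl : NatPoly l) (hi : NatPoly i) (hj : NatPoly j) :
    PropPoly fun m v => LayerTest m (l m v) (i m v) (j m v) :=
  (PropPoly.validGroup hi hj).and (((hl.eq (.const 0)).and ((NatPoly.groupEnd hi hj).eq .size)).or
    ((hl.eq (.const 0)).not.and (PropPoly.ex (PropPoly.ex
      ((NatPoly.eq (.load (by omega) (.address (hl.weaken.weaken.sub (.const 1))
        (NatPoly.var (V := V)).weaken .var)) (.const 1)).and
        (.compatible hi.weaken.weaken hj.weaken.weaken (NatPoly.var (V := V)).weaken .var))))))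

theorem NatPoly.leastBelow {P : State → V → ℕ → Prop}
    (hP : PropPoly fun m (v : V × ℕ) => P m v.1 v.2) :
    NatPoly fun m v => leastBelow (m.nat 0 0) (P m v) :=
  NatPoly.card (PropPoly.all ((NatPoly.var.le (NatPoly.var (V := V)).weaken).imp
    (PropPoly.not (P := fun m (v : (V × ℕ) × ℕ) => P m v.1.1 v.2) hP.weakenMiddle)))

theorem NatPoly.greatestSucc {P : State → V → ℕ → Prop}
    (hP : PropPoly fun m (v : V × ℕ) => P m v.1 v.2) :
    NatPoly fun m v => greatestSucc (m.nat 0 0) (P m v) :=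
  NatPoly.card (PropPoly.ex (((NatPoly.var (V := V)).weaken.le .var).and
    (P := fun _ (v : (V × ℕ) × ℕ) => v.1.2 ≤ v.2) (R := fun m v => P m v.1.1 v.2)
    hP.weakenMiddle))

theorem PropPoly.startTest (hl : NatPoly l) : PropPoly fun m v => StartTest m (l m v) :=
  PropPoly.ex (PropPoly.ex ((NatPoly.eq (.load (by omega) (.address hl.weaken.weaken
    (NatPoly.var (V := V)).weaken .var)) (.const 1)).and
      ((NatPoly.groupStart (NatPoly.var (V := V)).weaken .var).eq (.const 0))))

theorem PropPoly.choiceTest {q : State → V → ℕ} (hq : NatPoly q) (hi : NatPoly i)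
    (hj : NatPoly j) : PropPoly fun m v => ChoiceTest m (q m v) (i m v) (j m v) :=
  (NatPoly.eq (.load (by omega) (.address
    (((NatPoly.load (by omega) (.const 0)).sub (.const 1)).sub hq) hi hj)) (.const 1)).and
  (((hq.eq (.const 0)).imp ((NatPoly.groupStart hi hj).eq (.const 0))).and
    ((hq.eq (.const 0)).not.imp (.compatible (.load (by omega) (hq.sub (.const 1)))
      (.load (by omega) (hq.sub (.const 1))) hi hj)))

end closure

/-! ### The dynamic program as a composition of memory transformations -/

section program

open Classical

/-- Computes the entry `(l, i, j)` of the table. -/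
noncomputable def layerCmd (m : State) (v : ((Unit × ℕ) × ℕ) × ℕ) : State :=
  m.setNat 2 (address (m.nat 0 0) v.1.1.2 v.1.2 v.2)
    (if LayerTest m v.1.1.2 v.1.2 v.2 then 1 else 0)

/-- Computes the entries `(l, i, ·)` of the table. -/
noncomputable def rowCmd (m : State) (v : (Unit × ℕ) × ℕ) : State :=
  State.iterate (fun m' j => layerCmd m' (v, j)) m (m.nat 0 0)

/-- Computes the entries `(l, ·, ·)` of the table. -/
noncomputable def planeCmd (m : State) (v : Unit × ℕ) : State :=
  State.iterate (fun m' i => rowCmd m' (v, i)) m (m.nat 0 0)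

/-- Computes the table. -/
noncomputable def tableCmd (m : State) (v : Unit) : State :=
  State.iterate (fun m' l => planeCmd m' (v, l)) m (m.nat 0 0)

/-- Computes the maximum cardinality. -/
noncomputable def lengthCmd (m : State) (_ : Unit) : State :=
  m.setNat 3 0 (greatestSucc (m.nat 0 0) (StartTest m))

/-- Chooses the selected disk of the group number `q`. -/
noncomputable def centreCmd (m : State) (v : Unit × ℕ) : State :=
  m.setNat 4 v.2 (leastBelow (m.nat 0 0) fun i => ∃ j < m.nat 0 0, ChoiceTest m v.2 i j)

/-- Chooses the last disk of the group number `q`. -/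
noncomputable def lastCmd (m : State) (v : Unit × ℕ) : State :=
  m.setNat 5 v.2 (leastBelow (m.nat 0 0) fun j => ChoiceTest m v.2 (m.nat 4 v.2) j)

/-- Chooses the groups. -/
noncomputable def choiceCmd (m : State) (v : Unit) : State :=
  State.iterate (fun m' q => lastCmd (centreCmd m' (v, q)) (v, q)) m (m.nat 0 0)

/-- Assigns the disk `k`. -/
noncomputable def assignCmd (m : State) (v : Unit × ℕ) : State :=
  m.setNat 1 v.2 (∑ q ∈ Finset.range (m.nat 0 0),
    if q < m.nat 3 0 ∧ InGroup m (m.nat 4 q) (m.nat 5 q) v.2 then m.nat 4 q else 0)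

/-- Assigns all disks. -/
noncomputable def outputCmd (m : State) (v : Unit) : State :=
  State.iterate (fun m' k => assignCmd m' (v, k)) m (m.nat 0 0)

/-- Reports whether there is a proper assignment. -/
noncomputable def reportCmd (m : State) (_ : Unit) : State :=
  m.setNat 0 0 (if m.nat 0 0 ≠ 0 ∧ m.nat 3 0 = 0 then 0 else 1)

/-- The whole algorithm. -/
noncomputable def solveCmd (m : State) (v : Unit) : State :=
  reportCmd (outputCmd (choiceCmd (lengthCmd (tableCmd m v) v) v) v) v

theorem State.iterate_induction {f : State → ℕ → State} (I : ℕ → State → Prop) {m : State} (n : ℕ)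
    (h0 : I 0 m) (h : ∀ k < n, ∀ m', I k m' → I (k + 1) (f m' k)) :
    I n (State.iterate f m n) := by
  induction n with
  | zero => exact h0
  | succ n ih => exact h n (by omega) _ (ih fun k hk => h k (by omega))

theorem State.iterate_size {f : State → ℕ → State} (hf : ∀ m k, (f m k).nat 0 0 = m.nat 0 0)
    (m : State) (n : ℕ) : (State.iterate f m n).nat 0 0 = m.nat 0 0 :=
  State.iterate_induction (fun _ m' => m'.nat 0 0 = m.nat 0 0) n rfl
    fun k _ m' h => (hf m' k).trans h

theorem rowCmd_size (m : State) (v : (Unit × ℕ) × ℕ) : (rowCmd m v).nat 0 0 = m.nat 0 0 :=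
  State.iterate_size (fun m' k => by rfl) m (m.nat 0 0)

theorem planeCmd_size (m : State) (v : Unit × ℕ) : (planeCmd m v).nat 0 0 = m.nat 0 0 :=
  State.iterate_size (fun _ _ => rowCmd_size _ _) _ _

theorem tableCmd_size (m : State) (v : Unit) : (tableCmd m v).nat 0 0 = m.nat 0 0 :=
  State.iterate_size (fun _ _ => planeCmd_size _ _) _ _

theorem choiceCmd_size (m : State) (v : Unit) : (choiceCmd m v).nat 0 0 = m.nat 0 0 :=
  State.iterate_size (fun m' k => by rfl) m (m.nat 0 0)

theorem outputCmd_size (m : State) (v : Unit) : (outputCmd m v).nat 0 0 = m.nat 0 0 :=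
  State.iterate_size (fun m' k => by rfl) m (m.nat 0 0)

theorem CmdPoly.layerCmd : CmdPoly layerCmd :=
  have hl := (NatPoly.var (V := Unit)).weaken.weaken
  have hi := (NatPoly.var (V := Unit × ℕ)).weaken
  .store (by omega) (.address hl hi .var) (.ite (.layerTest hl hi .var) (.const 1) (.const 0))

theorem CmdPoly.tableCmd : CmdPoly tableCmd :=
  .forLoop (.forLoop (.forLoop .layerCmd fun _ _ => rfl) rowCmd_size) planeCmd_size

theorem CmdPoly.lengthCmd : CmdPoly lengthCmd :=
  .store (by omega) (.const 0) (.greatestSucc (.startTest .var))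

theorem CmdPoly.centreCmd : CmdPoly centreCmd :=
  .store (by omega) .var (.leastBelow (.ex
    (.choiceTest (NatPoly.var (V := Unit)).weaken.weaken (NatPoly.var (V := Unit × ℕ)).weaken .var)))

theorem CmdPoly.lastCmd : CmdPoly lastCmd :=
  .store (by omega) .var (.leastBelow (.choiceTest (NatPoly.var (V := Unit)).weaken
    (.load (by omega) (NatPoly.var (V := Unit)).weaken) .var))

theorem CmdPoly.choiceCmd : CmdPoly choiceCmd :=
  .forLoop (CmdPoly.centreCmd.seq .lastCmd fun _ _ => rfl) fun _ _ => rfl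

theorem CmdPoly.outputCmd : CmdPoly outputCmd :=
  have h4 := NatPoly.load (V := (Unit × ℕ) × ℕ) (a := 4) (by omega) .var
  .forLoop (.store (by omega) .var (.sum (.ite
    ((NatPoly.var.lt (.load (a := 3) (by omega) (.const 0))).and
      (.inGroup h4 (.load (a := 5) (by omega) .var) (NatPoly.var (V := Unit)).weaken))
      h4 (.const 0)))) fun _ _ => rfl

theorem CmdPoly.reportCmd : CmdPoly reportCmd :=
  .store (by omega) (.const 0) (.ite ((NatPoly.size.eq (.const 0)).not.and
    (.eq (.load (a := 3) (by omega) (.const 0)) (.const 0))) (.const 0) (.const 1))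

/-- Every phase preserves the size except `reportCmd`, which overwrites it with the verdict and
therefore comes last. -/
theorem CmdPoly.solveCmd : CmdPoly solveCmd :=
  (((CmdPoly.tableCmd.seq .lengthCmd tableCmd_size).seq .choiceCmd tableCmd_size).seq .outputCmd
    fun m v => (choiceCmd_size _ _).trans (tableCmd_size m v)).seq .reportCmd
    fun m v => (outputCmd_size _ _).trans ((choiceCmd_size _ _).trans (tableCmd_size m v))

end program

end RealRAM

/-! ### Groups and their extent on the line -/

namespace Disk

variable {n : ℕ} {D : Fin n → Disk} {t : Fin n → ℝ}

section precedes

variable {i j k l : Fin n}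

theorem Precedes.trans (h : Precedes D i k j) (h' : Precedes D i j l) : Precedes D i k l := by
  obtain ⟨h1, h2, h3⟩ := h
  obtain ⟨h4, h5, h6⟩ := h'
  refine ⟨h1, h5, ?_⟩
  rcases h3 with h3 | ⟨h3, h3'⟩ <;> rcases h6 with h6 | ⟨h6, h6'⟩
  · exact .inl (h3.trans h6)
  · exact .inl (h6 ▸ h3)
  · exact .inl (h3 ▸ h6)
  · exact .inr ⟨h3.trans h6, h3'.trans h6'⟩

theorem precedes_or_precedes (hk : k ≠ i) (hj : j ≠ i) (hkj : k ≠ j) :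
    Precedes D i k j ∨ Precedes D i j k := by
  rcases lt_trichotomy (distance D i k) (distance D i j) with h | h | h
  · exact .inl ⟨hk, hj, .inl h⟩
  · rcases lt_or_gt_of_ne hkj with h' | h'
    · exact .inl ⟨hk, hj, .inr ⟨h, h'⟩⟩
    · exact .inr ⟨hj, hk, .inr ⟨h.symm, h'⟩⟩
  · exact .inr ⟨hj, hk, .inl h⟩

theorem not_precedes_self : ¬ Precedes D i k k := fun h => by
  rcases h.2.2 with h | h
  · exact lt_irrefl _ h
  · exact lt_irrefl _ h.2

theorem precedes_of_distance_lt (hk : k ≠ i) (hj : j ≠ i) (h : distance D i k < distance D i j) :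
    Precedes D i k j :=
  ⟨hk, hj, .inl h⟩

end precedes

open Classical in
/-- The disks `i`, `j`, and those preceding `j` in the sequence of `i`. -/
noncomputable def group (D : Fin n → Disk) (i j : Fin n) : Finset (Fin n) :=
  Finset.univ.filter fun k => k = i ∨ k = j ∨ Precedes D i k j

theorem mem_group {i j k : Fin n} : k ∈ group D i j ↔ k = i ∨ k = j ∨ Precedes D i k j := by
  simp [group]

theorem self_mem_group (i j : Fin n) : i ∈ group D i j := mem_group.2 (.inl rfl)

theorem mem_group_of_precedes {i j k l : Fin n} (hk : k ∈ group D i j) (h : Precedes D i l k) :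
    l ∈ group D i j := by
  rcases mem_group.1 hk with rfl | rfl | hk
  · exact absurd rfl h.2.1
  · exact mem_group.2 (.inr (.inr h))
  · exact mem_group.2 (.inr (.inr (h.trans hk)))

/-- The disks of `group D i j` can be merged with `i`, and this group contains either all or none
of the disks with a given position. -/
def IsValidGroup (D : Fin n → Disk) (t : Fin n → ℝ) (i j : Fin n) : Prop :=
  (∀ k ∈ group D i j, k = i ∨ distance D i k < radiusBefore D i k) ∧
    ∀ k k', k ∈ group D i j → t k = t k' → k' ∈ group D i j

/-- The disks to the left of `group D i j`. -/
noncomputable def leftOf (D : Fin n → Disk) (t : Fin n → ℝ) (i j : Fin n) : Finset (Fin n) :=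
  Finset.univ.filter fun k => t k < t i ∧ k ∉ group D i j

/-- The disks in `group D i j` or to the left of it. -/
noncomputable def upTo (D : Fin n → Disk) (t : Fin n → ℝ) (i j : Fin n) : Finset (Fin n) :=
  Finset.univ.filter fun k => t k < t i ∨ k ∈ group D i j

theorem mem_leftOf {i j k : Fin n} : k ∈ leftOf D t i j ↔ t k < t i ∧ k ∉ group D i j := by
  simp [leftOf]

theorem mem_upTo {i j k : Fin n} : k ∈ upTo D t i j ↔ t k < t i ∨ k ∈ group D i j := by
  simp [upTo]

/-- The sum of the radii of the disks of `group D i j`. -/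
noncomputable def sumRadius (D : Fin n → Disk) (i j : Fin n) : ℝ :=
  ∑ k ∈ group D i j, (D k).radius

/-- The second group may directly follow the first one. -/
def IsNext (D : Fin n → Disk) (t : Fin n → ℝ) (i j i' j' : Fin n) : Prop :=
  (upTo D t i j).card = (leftOf D t i' j').card ∧ sumRadius D i j ≤ distance D i i' ∧
    sumRadius D i' j' ≤ distance D i i'

/-- Some sequence of `l + 1` groups starts with `group D i j` and ends at the right end. -/
def IsSuffix (D : Fin n → Disk) (t : Fin n → ℝ) : ℕ → Fin n → Fin n → Prop
  | 0, i, j => IsValidGroup D t i j ∧ (upTo D t i j).card = n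
  | l + 1, i, j => IsValidGroup D t i j ∧ ∃ i' j', IsSuffix D t l i' j' ∧ IsNext D t i j i' j'

theorem IsSuffix.isValidGroup {l : ℕ} {i j : Fin n} (h : IsSuffix D t l i j) :
    IsValidGroup D t i j := by
  cases l <;> exact h.1

/-- Initial segments of the left-to-right preorder; such a set never separates disks at the same
position. -/
def IsLower (t : Fin n → ℝ) (A : Finset (Fin n)) : Prop :=
  ∀ k ∈ A, ∀ k', t k' ≤ t k → k' ∈ A

/-- Lower sets of a total preorder are nested, hence determined by their size. This is why comparing
two counts suffices to see that one group begins where another ends. -/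
theorem IsLower.eq_of_card_eq {A B : Finset (Fin n)} (hA : IsLower t A) (hB : IsLower t B)
    (h : A.card = B.card) : A = B := by
  by_cases hAB : A ⊆ B
  · exact Finset.eq_of_subset_of_card_le hAB h.ge
  · obtain ⟨a, ha, ha'⟩ := Finset.not_subset.1 hAB
    refine (Finset.eq_of_subset_of_card_le (fun b hb => ?_) h.le).symm
    rcases le_total (t a) (t b) with hab | hab
    · exact absurd (hB b hb a hab) ha'
    · exact hA a ha b hab

section line

variable (hD : ∀ i j, distance D i j = |t i - t j|)
include hD

theorem distance_lt_of_lt_of_le {i k k' : Fin n} (h : t k' < t k) (h' : t k ≤ t i) :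
    distance D i k < distance D i k' := by
  rw [hD, hD, abs_of_nonneg (by linarith), abs_of_nonneg (by linarith)]
  linarith

theorem distance_lt_of_le_of_lt {i k k' : Fin n} (h : t k < t k') (h' : t i ≤ t k) :
    distance D i k < distance D i k' := by
  rw [hD, hD, abs_of_nonpos (by linarith), abs_of_nonpos (by linarith)]
  linarith

/-- A disk between a group member and the centre `i` is nearer to `i` and hence in the group, so a
disk left of `i` and outside the group has no member further left. Ties in position are settled by
the second clause of validity. -/
theorem IsValidGroup.isLower_leftOf {i j : Fin n} (h : IsValidGroup D t i j) :
    IsLower t (leftOf D t i j) := by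
  intro k hk k' hk'
  rw [mem_leftOf] at hk ⊢
  refine ⟨hk'.trans_lt hk.1, fun hg => hk.2 ?_⟩
  rcases hk'.eq_or_lt with he | hlt
  · exact h.2 _ _ hg he
  · refine mem_group_of_precedes hg (precedes_of_distance_lt ?_ ?_
      (distance_lt_of_lt_of_le hD hlt hk.1.le))
    · rintro rfl; exact lt_irrefl _ hk.1
    · rintro rfl; exact lt_irrefl _ (hlt.trans hk.1)

/-- The mirror argument: right of `i`, everything between `i` and a group member is nearer to `i`
than that member. -/
theorem IsValidGroup.isLower_upTo {i j : Fin n} (h : IsValidGroup D t i j) :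
    IsLower t (upTo D t i j) := by
  intro k hk k' hk'
  rw [mem_upTo] at hk ⊢
  by_cases hi : t k' < t i
  · exact .inl hi
  right
  push Not at hi
  have hg := hk.resolve_left (by linarith)
  rcases hi.eq_or_lt with he | hlt
  · exact h.2 _ _ (self_mem_group i j) he
  rcases hk'.eq_or_lt with he | hlt'
  · exact h.2 _ _ hg he.symm
  · refine mem_group_of_precedes hg (precedes_of_distance_lt ?_ ?_
      (distance_lt_of_le_of_lt hD hlt' hi))
    · rintro rfl; exact lt_irrefl _ hlt
    · rintro rfl; exact lt_irrefl _ (hlt.trans hlt')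

omit hD in
theorem leftOf_subset_upTo (i j : Fin n) : leftOf D t i j ⊆ upTo D t i j := fun _ hk =>
  mem_upTo.2 (.inl (mem_leftOf.1 hk).1)

omit hD in
theorem mem_group_or_mem_leftOf {i j k : Fin n} (h : k ∈ upTo D t i j) :
    k ∈ group D i j ∨ k ∈ leftOf D t i j := by
  rw [mem_upTo] at h
  rw [mem_leftOf]
  tauto

end line

/-! ### From sequences of groups to proper assignments -/

/-- A sequence of `M` groups that covers all disks from left to right. -/
structure IsChain (D : Fin n → Disk) (t : Fin n → ℝ) (M : ℕ) (I J : ℕ → Fin n) : Prop where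
  pos : 0 < M
  valid : ∀ q < M, IsValidGroup D t (I q) (J q)
  first : (leftOf D t (I 0) (J 0)).card = 0
  next : ∀ q, q + 1 < M → IsNext D t (I q) (J q) (I (q + 1)) (J (q + 1))
  last : (upTo D t (I (M - 1)) (J (M - 1))).card = n

namespace IsChain

variable {M : ℕ} {I J : ℕ → Fin n} (h : IsChain D t M I J)
  (hD : ∀ i j, distance D i j = |t i - t j|)
include h hD

theorem upTo_eq {q : ℕ} (hq : q + 1 < M) :
    upTo D t (I q) (J q) = leftOf D t (I (q + 1)) (J (q + 1)) :=
  ((h.valid q (by omega)).isLower_upTo hD).eq_of_card_eq ((h.valid _ hq).isLower_leftOf hD)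
    (h.next q hq).1

theorem upTo_subset {q r : ℕ} (hqr : q < r) (hr : r < M) :
    upTo D t (I q) (J q) ⊆ leftOf D t (I r) (J r) := by
  induction r, hqr using Nat.le_induction with
  | base => exact (h.upTo_eq hD hr).subset
  | succ r hqr ih =>
    exact ((ih (by omega)).trans (leftOf_subset_upTo _ _)).trans (h.upTo_eq hD hr).subset

/-- Descend from the last group, up to which everything lies: a disk up to group `q` is in that
group or left of it, hence up to group `q - 1`, and nothing is left of group `0`. -/
theorem exists_mem_group (k : Fin n) : ∃ q < M, k ∈ group D (I q) (J q) := by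
  have key : ∀ q < M, k ∈ upTo D t (I q) (J q) → ∃ q < M, k ∈ group D (I q) (J q) := by
    intro q
    induction q with
    | zero =>
      intro hq hk
      rcases mem_group_or_mem_leftOf hk with hk | hk
      · exact ⟨_, hq, hk⟩
      · simp [Finset.card_eq_zero.1 h.first] at hk
    | succ q ih =>
      intro hq hk
      rcases mem_group_or_mem_leftOf hk with hk | hk
      · exact ⟨_, hq, hk⟩
      · exact ih (by omega) ((h.upTo_eq hD hq).symm ▸ hk)
  have hM := h.pos
  refine key (M - 1) (by omega) ?_
  rw [(Finset.card_eq_iff_eq_univ _).1 (h.last.trans (Fintype.card_fin n).symm)]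
  exact Finset.mem_univ k

theorem notMem_group {q r : ℕ} (hqr : q < r) (hr : r < M) {k : Fin n}
    (hk : k ∈ group D (I q) (J q)) : k ∉ group D (I r) (J r) :=
  (mem_leftOf.1 (h.upTo_subset hD hqr hr (mem_upTo.2 (.inr hk)))).2

theorem eq_of_mem_group {q r : ℕ} (hq : q < M) (hr : r < M) {k : Fin n}
    (hk : k ∈ group D (I q) (J q)) (hk' : k ∈ group D (I r) (J r)) : q = r := by
  rcases lt_trichotomy q r with hqr | hqr | hqr
  · exact absurd hk' (h.notMem_group hD hqr hr hk)
  · exact hqr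
  · exact absurd hk (h.notMem_group hD hqr hq hk')

theorem position_lt {q r : ℕ} (hqr : q < r) (hr : r < M) : t (I q) < t (I r) :=
  (mem_leftOf.1 (h.upTo_subset hD hqr hr (mem_upTo.2 (.inr (self_mem_group _ _))))).1

theorem position_le {q r : ℕ} (hqr : q ≤ r) (hr : r < M) : t (I q) ≤ t (I r) := by
  rcases hqr.eq_or_lt with rfl | hqr
  · exact le_rfl
  · exact (h.position_lt hD hqr hr).le

/-- The centres of a chain increase along the line, so the bound for the neighbour on the relevant
side implies the bound for every centre beyond it. -/
theorem sumRadius_le {q r : ℕ} (hq : q < M) (hr : r < M) (hqr : q ≠ r) :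
    sumRadius D (I q) (J q) ≤ distance D (I q) (I r) := by
  rcases lt_or_gt_of_ne hqr with hqr | hqr
  · refine (h.next q (by omega)).2.1.trans ?_
    have h1 := h.position_le hD (show q ≤ q + 1 by omega) (by omega)
    have h2 := h.position_le hD (show q + 1 ≤ r by omega) hr
    rw [hD, hD, abs_of_nonpos (by linarith), abs_of_nonpos (by linarith)]
    linarith
  · obtain ⟨q, rfl⟩ : ∃ p, q = p + 1 := ⟨q - 1, by omega⟩
    refine (h.next q (by omega)).2.2.trans ?_
    have h1 := h.position_le hD (show q ≤ q + 1 by omega) (by omega)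
    have h2 := h.position_le hD (show r ≤ q by omega) (by omega)
    rw [hD, hD, abs_of_nonpos (by linarith), abs_of_nonneg (by linarith)]
    linarith

variable {φ : Fin n → Fin n} (hφ : ∀ q < M, ∀ k ∈ group D (I q) (J q), φ k = I q)
include hφ

theorem mem_group_iff {q : ℕ} (hq : q < M) {k : Fin n} :
    φ k = I q ↔ k ∈ group D (I q) (J q) := by
  refine ⟨fun hk => ?_, hφ q hq k⟩
  obtain ⟨r, hr, hkr⟩ := h.exists_mem_group hD k
  rw [hφ r hr k hkr] at hk
  have := h.eq_of_mem_group hD hr hq (self_mem_group _ _) (hk ▸ self_mem_group _ _)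
  exact this ▸ hkr

theorem isProper : IsProper D φ where
  isAssignment k := by
    obtain ⟨q, hq, hk⟩ := h.exists_mem_group hD k
    rw [hφ q hq k hk, hφ q hq _ (self_mem_group _ _)]
  merged_of_precedes i j k _ hi hk := by
    obtain ⟨q, hq, hj⟩ := h.exists_mem_group hD j
    obtain rfl : I q = i := (hφ q hq j hj).symm.trans hi
    exact hφ q hq k (mem_group_of_precedes hj hk)
  distance_lt i j hji hi := by
    obtain ⟨q, hq, hj⟩ := h.exists_mem_group hD j
    obtain rfl : I q = i := (hφ q hq j hj).symm.trans hi
    exact ((h.valid q hq).1 j hj).resolve_left hji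
  centre_disjoint i j hij hi hj := by
    obtain ⟨q, hq, hi'⟩ := h.exists_mem_group hD i
    obtain rfl : I q = i := (hφ q hq i hi').symm.trans hi
    obtain ⟨r, hr, hj'⟩ := h.exists_mem_group hD j
    obtain rfl : I r = j := (hφ r hr j hj').symm.trans hj
    refine le_of_eq_of_le ?_ (h.sumRadius_le hD hq hr (by rintro rfl; exact hij rfl))
    refine Finset.sum_congr ?_ fun _ _ => rfl
    ext k
    simp [h.mem_group_iff hD hφ hq]

theorem cardinality_eq : cardinality φ = M := by
  rw [cardinality, ← Finset.card_range M]
  symm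
  refine Finset.card_bij (fun q _ => I q) ?_ ?_ ?_
  · intro q hq
    simpa using hφ q (Finset.mem_range.1 hq) _ (self_mem_group _ _)
  · intro q hq r hr hqr
    exact h.eq_of_mem_group hD (Finset.mem_range.1 hq) (Finset.mem_range.1 hr)
      (self_mem_group _ _) (hqr ▸ self_mem_group _ _)
  · intro i hi
    obtain ⟨q, hq, hi'⟩ := h.exists_mem_group hD i
    exact ⟨q, Finset.mem_range.2 hq, (hφ q hq i hi').symm.trans (Finset.mem_filter.1 hi).2⟩

end IsChain

/-! ### From proper assignments to sequences of groups -/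

namespace IsProper

variable {φ : Fin n → Fin n} (h : IsProper D φ)
include h

/-- Closure under predecessors makes the cluster of `i` a prefix of its sequence, so its last member
describes it. -/
theorem exists_group_eq {i : Fin n} (hi : φ i = i) :
    ∃ j, ∀ k, k ∈ group D i j ↔ φ k = i := by
  classical
  by_cases hne : ∃ k, k ≠ i ∧ φ k = i
  · -- the last disk merged with `i` is the one preceded by the greatest number of disks
    obtain ⟨j, hj, hmax⟩ := Finset.exists_max_image
      (Finset.univ.filter fun k => k ≠ i ∧ φ k = i)
      (fun k => (Finset.univ.filter fun l => Precedes D i l k).card)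
      (by obtain ⟨k, hk⟩ := hne; exact ⟨k, by simpa using hk⟩)
    simp only [Finset.mem_filter, Finset.mem_univ, true_and] at hj hmax
    refine ⟨j, fun k => ⟨fun hk => ?_, fun hk => ?_⟩⟩
    · rcases mem_group.1 hk with rfl | rfl | hk
      · exact hi
      · exact hj.2
      · exact h.merged_of_precedes i j k hj.1 hj.2 hk
    · by_cases hki : k = i
      · exact hki ▸ self_mem_group _ _
      by_cases hkj : k = j
      · exact mem_group.2 (.inr (.inl hkj))
      rcases precedes_or_precedes hki hj.1 hkj with hp | hp
      · exact mem_group.2 (.inr (.inr hp))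
      -- If `j` preceded `k`, the predecessors of `k` would include those of `j` and also `j`
      -- itself, against maximality.
      · refine absurd (hmax k ⟨hki, hk⟩) (not_le.2 (Finset.card_lt_card ?_))
        refine Finset.ssubset_iff_subset_ne.2 ⟨fun l hl => ?_, fun he => ?_⟩
        · simp only [Finset.mem_filter, Finset.mem_univ, true_and] at hl ⊢
          exact hl.trans hp
        · have : j ∈ Finset.univ.filter fun l => Precedes D i l k := by simpa using hp
          rw [← he] at this
          exact not_precedes_self (Finset.mem_filter.1 this).2
  · push Not at hne
    -- Nothing is merged with `i`; the choice `j = i` encodes the singleton, as no disk precedes `i`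
    -- in its own sequence.
    refine ⟨i, fun k => ⟨fun hk => ?_, fun hk => ?_⟩⟩
    · rcases mem_group.1 hk with rfl | rfl | hk
      · exact hi
      · exact hi
      · exact absurd rfl hk.2.1
    · by_cases hki : k = i
      · exact hki ▸ self_mem_group _ _
      · exact absurd hk (hne k hki)

theorem radiusBefore_le {i j : Fin n} (hji : j ≠ i) (hj : φ j = i) :
    radiusBefore D i j ≤ aggregateRadius D φ i := by
  classical
  have hi : φ i = i := by rw [← hj]; exact h.isAssignment j
  have hni : i ∉ Finset.univ.filter fun k => Precedes D i k j :=
    fun hm => (Finset.mem_filter.1 hm).2.1 rfl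
  rw [radiusBefore, aggregateRadius]
  rw [← Finset.sum_insert (f := fun k => (D k).radius) (by convert hni)]
  refine Finset.sum_le_sum_of_subset_of_nonneg (fun k hk => ?_) fun k _ _ => (D k).radius_pos.le
  rw [Finset.mem_insert, Finset.mem_filter] at hk
  rcases hk with rfl | hk
  · simpa using hi
  · simpa using h.merged_of_precedes i j k hji hj hk.2

omit h in
theorem radius_le_aggregateRadius {i : Fin n} (hi : φ i = i) :
    (D i).radius ≤ aggregateRadius D φ i :=
  Finset.single_le_sum (f := fun k => (D k).radius) (fun k _ => (D k).radius_pos.le)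
    (by simpa using hi)

variable (hD : ∀ i j, distance D i j = |t i - t j|)
include hD

/-- Nothing selected, other than `i`, has the position of a disk assigned to `i`. -/
theorem eq_of_position_eq {i j k : Fin n} (hj : φ j = i) (hk : φ k = k) (hjk : t j = t k) :
    k = i := by
  by_contra hki
  have hi : φ i = i := by rw [← hj]; exact h.isAssignment j
  -- Both cases contradict this bound. If `j = i`, the distance is zero but the aggregate radius is
  -- positive; otherwise condition 2 makes the distance of `j`, which equals that of `k`, smaller
  -- than the aggregate radius.
  have h1 := h.centre_disjoint i k (Ne.symm hki) hi hk
  have h2 : distance D i j = distance D i k := by rw [hD, hD, hjk]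
  by_cases hji : j = i
  · subst hji
    have h3 := radius_le_aggregateRadius (D := D) hi
    have h4 := (D j).radius_pos
    rw [hD, hjk, sub_self, abs_zero] at h1
    linarith
  · have h3 := h.distance_lt i j hji hj
    have h4 := h.radiusBefore_le hji hj
    linarith

/-- If neither disk is selected, the one of smaller index precedes the other in the sequence of the
disk with which the other is merged, being at the same distance; condition 1 then merges it there
too. -/
theorem apply_eq_of_position_eq {j k : Fin n} (hjk : t j = t k) : φ j = φ k := by
  by_cases hj : φ j = j
  · exact hj.trans (h.eq_of_position_eq hD rfl hj hjk.symm)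
  by_cases hk : φ k = k
  · exact ((h.eq_of_position_eq hD rfl hk hjk).symm.trans hk.symm)
  rcases lt_trichotomy j k with hlt | rfl | hlt
  · refine h.merged_of_precedes (φ k) k j (Ne.symm hk) rfl ⟨?_, Ne.symm hk, .inr ⟨?_, hlt⟩⟩
    · intro he
      exact hj (he ▸ h.isAssignment k)
    · rw [hD, hD, hjk]
  · rfl
  · refine (h.merged_of_precedes (φ j) j k (Ne.symm hj) rfl
      ⟨?_, Ne.symm hj, .inr ⟨?_, hlt⟩⟩).symm
    · intro he
      exact hk (he ▸ h.isAssignment j)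
    · rw [hD, hD, hjk]

theorem isValidGroup {i j : Fin n} (hj : ∀ k, k ∈ group D i j ↔ φ k = i) :
    IsValidGroup D t i j := by
  refine ⟨fun k hk => ?_, fun k k' hk hkk' => ?_⟩
  · by_cases hki : k = i
    · exact .inl hki
    · exact .inr (h.distance_lt i k hki ((hj k).1 hk))
  · rw [hj] at hk ⊢
    rw [← h.apply_eq_of_position_eq hD hkk', hk]

/-- Clusters do not interleave: if `i` lay between `k` and `φ k`, it would be nearer to `φ k` than
`k` is and would have to be merged with `φ k`, although it is selected. -/
theorem position_lt_iff {i : Fin n} (hi : φ i = i) (k : Fin n) :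
    t (φ k) < t i ↔ t k < t i ∧ φ k ≠ i := by
  constructor
  · intro hlt
    have hne : φ k ≠ i := by rintro he; rw [he] at hlt; exact lt_irrefl _ hlt
    refine ⟨?_, hne⟩
    by_contra hk
    push Not at hk
    rcases hk.eq_or_lt with he | hk
    · exact hne (by rw [← h.apply_eq_of_position_eq hD he, hi])
    · have hp : Precedes D (φ k) i k := precedes_of_distance_lt hne.symm
        (by rintro he; rw [← he] at hlt; exact lt_irrefl _ (hlt.trans hk))
        (distance_lt_of_le_of_lt hD hk hlt.le)
      exact hne ((h.merged_of_precedes _ k i hp.2.1 rfl hp).symm.trans hi)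
  · rintro ⟨hk, hne⟩
    by_contra hlt
    push Not at hlt
    rcases hlt.eq_or_lt with he | hlt
    · exact hne (h.eq_of_position_eq hD hi (h.isAssignment k) he)
    · have hp : Precedes D (φ k) i k := precedes_of_distance_lt hne.symm
        (by rintro he; rw [← he] at hlt; exact lt_irrefl _ (hlt.trans hk))
        (distance_lt_of_lt_of_le hD hk hlt.le)
      exact hne ((h.merged_of_precedes _ k i hp.2.1 rfl hp).symm.trans hi)

theorem leftOf_eq {i j : Fin n} (hi : φ i = i) (hj : ∀ k, k ∈ group D i j ↔ φ k = i) :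
    leftOf D t i j = Finset.univ.filter fun k => t (φ k) < t i := by
  ext k
  simp [mem_leftOf, h.position_lt_iff hD hi, hj]

theorem upTo_eq {i j : Fin n} (hi : φ i = i) (hj : ∀ k, k ∈ group D i j ↔ φ k = i) :
    upTo D t i j = Finset.univ.filter fun k => t (φ k) ≤ t i := by
  ext k
  have : t (φ k) = t i ↔ φ k = i :=
    ⟨fun he => h.eq_of_position_eq hD hi (h.isAssignment k) he.symm, fun he => by rw [he]⟩
  simp only [mem_upTo, le_iff_lt_or_eq, h.position_lt_iff hD hi, hj, this, Finset.mem_filter,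
    Finset.mem_univ, true_and]
  tauto

omit h hD in
theorem sumRadius_eq {i j : Fin n} (hj : ∀ k, k ∈ group D i j ↔ φ k = i) :
    sumRadius D i j = aggregateRadius D φ i := by
  refine Finset.sum_congr ?_ fun _ _ => rfl
  ext k
  simp [hj]

/-- Induction on the number of selected disks right of `i`; the next group is that of the leftmost
of them. -/
theorem isSuffix (l : ℕ) {i j : Fin n} (hi : φ i = i) (hj : ∀ k, k ∈ group D i j ↔ φ k = i)
    (hl : (Finset.univ.filter fun k => φ k = k ∧ t i < t k).card = l) : IsSuffix D t l i j := by
  induction l generalizing i j with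
  | zero =>
    refine ⟨h.isValidGroup hD hj, ?_⟩
    rw [h.upTo_eq hD hi hj, Finset.filter_true_of_mem, Finset.card_univ, Fintype.card_fin]
    intro k _
    by_contra hk
    rw [Finset.card_eq_zero, Finset.filter_eq_empty_iff] at hl
    exact hl (Finset.mem_univ (φ k)) ⟨h.isAssignment k, not_le.1 hk⟩
  | succ l ih =>
    obtain ⟨i', hi', hmin⟩ := Finset.exists_min_image
      (Finset.univ.filter fun k => φ k = k ∧ t i < t k) t
      (Finset.card_pos.1 (by omega))
    simp only [Finset.mem_filter, Finset.mem_univ, true_and] at hi' hmin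
    obtain ⟨j', hj'⟩ := h.exists_group_eq hi'.1
    refine ⟨h.isValidGroup hD hj, i', j', ih hi'.1 hj' ?_, ?_, ?_, ?_⟩
    · have : (Finset.univ.filter fun k => φ k = k ∧ t i < t k) =
          insert i' (Finset.univ.filter fun k => φ k = k ∧ t i' < t k) := by
        ext k
        simp only [Finset.mem_filter, Finset.mem_univ, true_and, Finset.mem_insert]
        constructor
        · intro hk
          rcases (hmin k hk).eq_or_lt with he | hlt
          · exact .inl (h.eq_of_position_eq hD hi'.1 hk.1 he)
          · exact .inr ⟨hk.1, hlt⟩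
        · rintro (rfl | hk)
          · exact hi'
          · exact ⟨hk.1, hi'.2.trans hk.2⟩
      rw [this, Finset.card_insert_of_notMem (by simp)] at hl
      omega
    · rw [h.upTo_eq hD hi hj, h.leftOf_eq hD hi'.1 hj']
      congr 1
      ext k
      simp only [Finset.mem_filter, Finset.mem_univ, true_and]
      refine ⟨fun hk => hk.trans_lt hi'.2, fun hk => ?_⟩
      by_contra hk'
      exact absurd (hmin (φ k) ⟨h.isAssignment k, not_le.1 hk'⟩) (not_le.2 hk)
    · rw [sumRadius_eq hj]
      exact h.centre_disjoint i i' (by rintro rfl; exact lt_irrefl _ hi'.2) hi hi'.1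
    · rw [sumRadius_eq hj', hD, abs_sub_comm, ← hD]
      exact h.centre_disjoint i' i (by rintro rfl; exact lt_irrefl _ hi'.2) hi'.1 hi

theorem exists_isSuffix (hn : 0 < n) :
    ∃ l i j, cardinality φ = l + 1 ∧ IsSuffix D t l i j ∧ (leftOf D t i j).card = 0 := by
  obtain ⟨i, hi, hmin⟩ := Finset.exists_min_image (Finset.univ.filter fun k => φ k = k) t
    ⟨φ ⟨0, hn⟩, by simpa using h.isAssignment _⟩
  simp only [Finset.mem_filter, Finset.mem_univ, true_and] at hi hmin
  obtain ⟨j, hj⟩ := h.exists_group_eq hi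
  refine ⟨_, i, j, ?_, h.isSuffix hD _ hi hj rfl, ?_⟩
  · have : (Finset.univ.filter fun k => φ k = k) =
        insert i (Finset.univ.filter fun k => φ k = k ∧ t i < t k) := by
      ext k
      simp only [Finset.mem_filter, Finset.mem_univ, true_and, Finset.mem_insert]
      constructor
      · intro hk
        rcases (hmin k hk).eq_or_lt with he | hlt
        · exact .inl (h.eq_of_position_eq hD hi hk he)
        · exact .inr ⟨hk, hlt⟩
      · rintro (rfl | hk)
        · exact hi
        · exact hk.1
    rw [cardinality, this, Finset.card_insert_of_notMem (by simp)]
  · rw [h.leftOf_eq hD hi hj, Finset.card_eq_zero, Finset.filter_eq_empty_iff]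
    intro k _
    exact not_lt.2 (hmin _ (h.isAssignment k))

end IsProper

/-! ### Size bound and coordinates on the line -/

theorem cardinality_le (φ : Fin n → Fin n) : cardinality φ ≤ n :=
  (Finset.card_filter_le _ _).trans (by simp)

/-- Positions on the line, such that the order from left to right is the lexicographic one. -/
theorem exists_position (hcol : Collinear ℝ (Set.range fun i => (D i).centre)) :
    ∃ t : Fin n → ℝ, (∀ i j, distance D i j = |t i - t j|) ∧
      ∀ i j, t i < t j ↔ (D i).centre 0 < (D j).centre 0 ∨
        (D i).centre 0 = (D j).centre 0 ∧ (D i).centre 1 < (D j).centre 1 := by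
  obtain ⟨p, v, hv⟩ := (collinear_iff_exists_forall_eq_smul_vadd (k := ℝ) _).1 hcol
  choose r hr using fun i => hv _ ⟨i, rfl⟩
  have hc : ∀ i a, (D i).centre a = r i * v a + p a := fun i a => by
    have := congrArg (fun x : EuclideanSpace ℝ (Fin 2) => x a) (hr i)
    simpa using this
  have hdist : ∀ i j, distance D i j = |r i - r j| * ‖v‖ := fun i j => by
    have h1 : (D i).centre = r i • v +ᵥ p := hr i
    have h2 : (D j).centre = r j • v +ᵥ p := hr j
    rw [distance, h1, h2, dist_vadd_cancel_right, dist_eq_norm, ← sub_smul, norm_smul,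
      Real.norm_eq_abs]
  -- The sign `σ` orients the direction vector so that its first nonzero coordinate is positive;
  -- then increasing position is increasing lexicographic order.
  have hsign : ∀ σ : ℝ, |σ| = 1 → 0 < σ * v 0 ∨ v 0 = 0 ∧ 0 < σ * v 1 →
      ∃ t : Fin n → ℝ, (∀ i j, distance D i j = |t i - t j|) ∧
      ∀ i j, t i < t j ↔ (D i).centre 0 < (D j).centre 0 ∨
        (D i).centre 0 = (D j).centre 0 ∧ (D i).centre 1 < (D j).centre 1 := by
    intro σ hσ hpos
    have hσ2 : σ * σ = 1 := by rw [← abs_mul_abs_self, hσ, one_mul]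
    have hvn : 0 < ‖v‖ := norm_pos_iff.2 (by rintro rfl; simp at hpos)
    refine ⟨fun i => σ * r i * ‖v‖, fun i j => ?_, fun i j => ?_⟩
    · rw [hdist, ← sub_mul, ← mul_sub, abs_mul, abs_mul, hσ, one_mul, abs_norm]
    · have key : ∀ a, 0 < σ * v a → (σ * r i < σ * r j ↔ r i * v a < r j * v a) := fun a ha => by
        rw [← mul_lt_mul_iff_left₀ ha, show σ * r i * (σ * v a) = σ * σ * (r i * v a) by ring,
          show σ * r j * (σ * v a) = σ * σ * (r j * v a) by ring, hσ2, one_mul, one_mul]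
      rw [mul_lt_mul_iff_left₀ hvn]
      simp only [hc, add_lt_add_iff_right, add_left_inj]
      rcases hpos with hpos | ⟨h0, hpos⟩
      · have hv0 : v 0 ≠ 0 := by rintro h; simp [h] at hpos
        rw [key 0 hpos]
        refine ⟨.inl, ?_⟩
        rintro (h | ⟨h, h'⟩)
        · exact h
        · rw [mul_right_cancel₀ hv0 h] at h'
          exact absurd h' (lt_irrefl _)
      · rw [key 1 hpos]
        simp [h0]
  rcases lt_trichotomy (v 0) 0 with h | h | h
  · exact hsign (-1) (by simp) (.inl (by linarith))
  · rcases lt_trichotomy (v 1) 0 with h' | h' | h'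
    · exact hsign (-1) (by simp) (.inr ⟨h, by linarith⟩)
    -- All centres coincide, and a constant position works.
    · have : v = 0 := by
        ext a
        fin_cases a
        · exact h
        · exact h'
      exact ⟨fun _ => 0, fun i j => by simp [hdist, this], fun i j => by simp [hc, h, h']⟩
    · exact hsign 1 (by simp) (.inr ⟨h, by linarith⟩)
  · exact hsign 1 (by simp) (.inl (by linarith))

end Disk

/-! ### The memory contents and their geometric meaning -/

namespace RealRAM

section counting

variable {n : ℕ} {P : ℕ → Prop}

/-- A downward closed predicate selects an initial segment, whose length is its first failure. Hence
searching can be done by counting. -/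
theorem lt_card_filter_range_iff [DecidablePred P] (hP : ∀ k < n, P k → ∀ k' ≤ k, P k') (k : ℕ) :
    k < ((Finset.range n).filter P).card ↔ k < n ∧ P k := by
  constructor
  · intro h
    by_contra hk
    refine absurd h (not_lt.2 ?_)
    rw [← Finset.card_range k]
    refine Finset.card_le_card fun x hx => ?_
    rw [Finset.mem_filter, Finset.mem_range] at hx
    rw [Finset.mem_range]
    by_contra hkx
    exact hk ⟨by omega, hP x hx.1 hx.2 k (by omega)⟩
  · rintro ⟨hk, hPk⟩
    rw [← Nat.succ_le_iff, Nat.succ_eq_add_one, ← Finset.card_range (k + 1)]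
    refine Finset.card_le_card fun x hx => ?_
    rw [Finset.mem_range] at hx
    exact Finset.mem_filter.2 ⟨Finset.mem_range.2 (by omega), hP k hk hPk x (by omega)⟩

theorem leastBelow_spec (h : ∃ k < n, P k) : leastBelow n P < n ∧ P (leastBelow n P) := by
  classical
  have key := lt_card_filter_range_iff (n := n) (P := fun k => ∀ k' < n, k' ≤ k → ¬ P k')
    (fun k _ hk l hl k' hk' hkl => hk k' hk' (hkl.trans hl))
  have hc : ∀ k, k < leastBelow n P ↔ k < n ∧ ∀ k' < n, k' ≤ k → ¬ P k' := fun k => by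
    rw [← key k, leastBelow]
  obtain ⟨k, hk, hPk⟩ := h
  have hlt : leastBelow n P < n := by
    by_contra hn
    exact ((hc k).1 (by omega)).2 k hk le_rfl hPk
  refine ⟨hlt, ?_⟩
  by_contra hnot
  refine lt_irrefl _ ((hc _).2 ⟨hlt, fun k' hk' hle hPk' => ?_⟩)
  rcases hle.eq_or_lt with rfl | hlt'
  · exact hnot hPk'
  · exact ((hc k').1 hlt').2 k' hk' le_rfl hPk'

theorem lt_greatestSucc_iff (k : ℕ) : k < greatestSucc n P ↔ ∃ k' < n, k ≤ k' ∧ P k' := by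
  classical
  have key := lt_card_filter_range_iff (n := n) (P := fun k => ∃ k' < n, k ≤ k' ∧ P k')
    (fun k _ ⟨k', h1, h2, h3⟩ l hl => ⟨k', h1, hl.trans h2, h3⟩) k
  have hc : k < greatestSucc n P ↔ k < n ∧ ∃ k' < n, k ≤ k' ∧ P k' := by
    rw [← key, greatestSucc]
  rw [hc]
  exact ⟨And.right, fun ⟨k', h1, h2, h3⟩ => ⟨by omega, k', h1, h2, h3⟩⟩

theorem greatestSucc_spec (h : greatestSucc n P ≠ 0) :
    greatestSucc n P ≤ n ∧ P (greatestSucc n P - 1) := by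
  obtain ⟨k, h1, h2, h3⟩ := (lt_greatestSucc_iff (n := n) (P := P) _).1 (Nat.sub_one_lt h)
  have := (lt_greatestSucc_iff k).2 ⟨k, h1, le_rfl, h3⟩
  obtain rfl : k = greatestSucc n P - 1 := by omega
  exact ⟨by omega, h3⟩

end counting

/-- An address has `j` and `i` as its two lowest digits in base `n`; `l` is the unbounded rest. -/
theorem address_injective {n l l' : ℕ} {i j i' j' : Fin n}
    (h : address n l i j = address n l' i' j') : l = l' ∧ i = i' ∧ j = j' := by
  have aux : ∀ (a b : ℕ) (c d : Fin n), a * n + c = b * n + d → a = b ∧ c = d := by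
    intro a b c d h
    have hn : 0 < n := c.pos
    have h1 := congrArg (· / n) h
    have h2 := congrArg (· % n) h
    simp only [mul_comm _ n, Nat.mul_add_div hn, Nat.div_eq_of_lt c.2, Nat.div_eq_of_lt d.2,
      Nat.mul_add_mod, Nat.mod_eq_of_lt c.2, Nat.mod_eq_of_lt d.2] at h1 h2
    exact ⟨by omega, Fin.ext h2⟩
  obtain ⟨h1, h2⟩ := aux _ _ _ _ h
  obtain ⟨h3, h4⟩ := aux _ _ _ _ h1
  exact ⟨h3, h4, h2⟩

theorem forall_lt_forall_lt_iff {n : ℕ} {P : ℕ → ℕ → Prop} :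
    (∀ k < n, ∀ k' < n, P k k') ↔ ∀ k k' : Fin n, P k k' :=
  ⟨fun h k k' => h k k.2 k' k'.2, fun h k hk k' hk' => h ⟨k, hk⟩ ⟨k', hk'⟩⟩

/-- The memory `m` contains the disks `D`. -/
structure Holds {n : ℕ} (D : Fin n → Disk) (m : State) : Prop where
  size : m.nat 0 0 = n
  real : m.real = (input D).real

section instances

variable {n : ℕ} {D : Fin n → Disk} {m : State} {t : Fin n → ℝ}

theorem holds_input : Holds D (input D) := ⟨rfl, rfl⟩

theorem Holds.setNat (h : Holds D m) {a : ℕ} (ha : a ≠ 0) (k v : ℕ) : Holds D (m.setNat a k v) :=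
  ⟨by simp [Function.update_of_ne ha.symm, h.size], h.real⟩

variable (h : Holds D m)
include h

theorem Holds.fst (i : Fin n) : m.real 0 i = (D i).centre 0 := by
  simp [h.real, input, arrayOf]

theorem Holds.snd (i : Fin n) : m.real 1 i = (D i).centre 1 := by
  simp [h.real, input, arrayOf]

theorem Holds.radius (i : Fin n) : m.real 2 i = (D i).radius := by
  simp [h.real, input, arrayOf]

theorem Holds.sqDist_eq (i j : Fin n) :
    sqDist m i j = Disk.distance D i j * Disk.distance D i j := by
  rw [sqDist, h.fst, h.fst, h.snd, h.snd, Disk.distance, EuclideanSpace.dist_eq,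
    Real.mul_self_sqrt (by positivity)]
  simp [Fin.sum_univ_two, Real.dist_eq, sq]

/-- Distances are nonnegative, so comparing their squares, which the machine can compute, decides
the same order and the same ties. -/
theorem Holds.before_iff (i k j : Fin n) : Before m i k j ↔ Disk.Precedes D i k j := by
  have h1 : 0 ≤ Disk.distance D i k := dist_nonneg
  have h2 : 0 ≤ Disk.distance D i j := dist_nonneg
  simp only [Before, Disk.Precedes, h.sqDist_eq, ← Fin.ext_iff, ne_eq, Fin.lt_def,
    mul_self_lt_mul_self_iff h1 h2, mul_self_inj h1 h2]

theorem Holds.inGroup_iff (i j k : Fin n) : InGroup m i j k ↔ k ∈ Disk.group D i j := by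
  simp only [InGroup, Disk.mem_group, h.before_iff, ← Fin.ext_iff]

theorem Holds.radiusUpTo_eq (i j : Fin n) : radiusUpTo m i j = Disk.radiusBefore D i j := by
  rw [radiusUpTo, Disk.radiusBefore, h.size, h.radius, Finset.sum_range, Finset.sum_filter]
  refine congrArg _ (Finset.sum_congr rfl fun k _ => ?_)
  rw [h.radius, Nat.cast_zero]
  have := h.before_iff i k j
  split_ifs <;> tauto

theorem Holds.groupRadius_eq (i j : Fin n) : groupRadius m i j = Disk.sumRadius D i j := by
  classical
  rw [groupRadius, Disk.sumRadius, h.size, Finset.sum_range]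
  refine (Finset.sum_congr rfl fun k _ => ?_).trans ((Finset.sum_ite_mem Finset.univ _
    fun k => (D k).radius).trans (by rw [Finset.univ_inter]))
  rw [h.radius, Nat.cast_zero]
  simp only [h.inGroup_iff]

theorem Holds.card_filter_range (P : ℕ → Prop) (A : Finset (Fin n)) {_ : DecidablePred P}
    (hP : ∀ k : Fin n, P k ↔ k ∈ A) :
    ((Finset.range (m.nat 0 0)).filter P).card = A.card := by
  rw [Finset.card_filter, h.size, Finset.sum_range]
  simp [hP]

variable (ht : ∀ i j, t i < t j ↔ (D i).centre 0 < (D j).centre 0 ∨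
  (D i).centre 0 = (D j).centre 0 ∧ (D i).centre 1 < (D j).centre 1)
include ht

theorem Holds.lexLeft_iff (i j : Fin n) : LexLeft m i j ↔ t i < t j := by
  rw [ht, LexLeft, h.fst, h.fst, h.snd, h.snd]

theorem Holds.groupStart_eq (i j : Fin n) : groupStart m i j = (Disk.leftOf D t i j).card :=
  h.card_filter_range _ _ fun k => by
    rw [Disk.mem_leftOf, h.lexLeft_iff ht, h.inGroup_iff]

theorem Holds.groupEnd_eq (i j : Fin n) : groupEnd m i j = (Disk.upTo D t i j).card :=
  h.card_filter_range _ _ fun k => by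
    rw [Disk.mem_upTo, h.lexLeft_iff ht, h.inGroup_iff]

theorem Holds.validGroup_iff (i j : Fin n) : ValidGroup m i j ↔ Disk.IsValidGroup D t i j := by
  have h0 : ∀ i k, 0 ≤ Disk.radiusBefore D i k := fun i k =>
    add_nonneg (D i).radius_pos.le (Finset.sum_nonneg fun k _ => (D k).radius_pos.le)
  rw [ValidGroup, h.size, Disk.IsValidGroup]
  refine and_congr ((Fin.forall_iff (p := fun k : Fin n => InGroup m i j k → (k : ℕ) = i ∨
      sqDist m i k < radiusUpTo m i k * radiusUpTo m i k)).symm.trans (forall_congr' fun k => ?_))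
    ((forall_lt_forall_lt_iff (P := fun k k' => InGroup m i j k →
      ¬ LexLeft m k k' ∧ ¬ LexLeft m k' k → InGroup m i j k')).trans
      (forall_congr' fun k => forall_congr' fun k' => ?_))
  · rw [h.inGroup_iff, h.sqDist_eq, h.radiusUpTo_eq, ← Fin.ext_iff,
      ← mul_self_lt_mul_self_iff (show 0 ≤ Disk.distance D i k from dist_nonneg) (h0 i k)]
  -- Neither disk being lexicographically left of the other means equality of positions.
  · rw [h.inGroup_iff, h.inGroup_iff, h.lexLeft_iff ht, h.lexLeft_iff ht, not_lt, not_lt, and_comm,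
      ← le_antisymm_iff]

theorem Holds.compatible_iff (i j i' j' : Fin n) :
    Compatible m i j i' j' ↔ Disk.IsNext D t i j i' j' := by
  have h0 : ∀ i j, 0 ≤ Disk.sumRadius D i j := fun i j =>
    Finset.sum_nonneg fun k _ => (D k).radius_pos.le
  have hd : 0 ≤ Disk.distance D i i' := dist_nonneg
  rw [Compatible, Disk.IsNext, h.groupEnd_eq ht, h.groupStart_eq ht, h.groupRadius_eq,
    h.groupRadius_eq, h.sqDist_eq, mul_self_le_mul_self_iff (h0 i j) hd,
    mul_self_le_mul_self_iff (h0 i' j') hd]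

end instances

/-! ### Correctness of the dynamic program -/

section correctness

variable {n : ℕ} {D : Fin n → Disk} {m : State} {t : Fin n → ℝ}

/-- The table contains the correct entries below the address `p`. -/
structure TableBelow (D : Fin n → Disk) (t : Fin n → ℝ) (p : ℕ) (m : State) : Prop
    extends Holds D m where
  entry : ∀ l (i j : Fin n), address n l i j < p →
    (m.nat 2 (address n l i j) = 1 ↔ Disk.IsSuffix D t l i j)

/-- All addresses of an earlier layer are smaller, so a test that reads the previous layer reads
only finished entries. -/
theorem address_lt_address {l l' : ℕ} (hl : l < l') {i j : Fin n} (i' j' : ℕ) :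
    address n l i j < address n l' i' j' := by
  have h1 : (l * n + i + 1) * n ≤ (l' * n + i') * n := by
    refine Nat.mul_le_mul_right n ?_
    have := Nat.mul_le_mul_right n (Nat.succ_le_of_lt hl)
    rw [Nat.succ_mul] at this
    have := i.2
    omega
  have := j.2
  rw [Nat.succ_mul] at h1
  unfold address
  omega

variable (ht : ∀ i j, t i < t j ↔ (D i).centre 0 < (D j).centre 0 ∨
  (D i).centre 0 = (D j).centre 0 ∧ (D i).centre 1 < (D j).centre 1)
include ht

theorem TableBelow.layerTest_iff {l : ℕ} {i j : Fin n}
    (h : TableBelow D t (address n l i j) m) :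
    LayerTest m l i j ↔ Disk.IsSuffix D t l i j := by
  rw [LayerTest, h.validGroup_iff ht, h.groupEnd_eq ht, h.size]
  cases l with
  | zero => simp [Disk.IsSuffix]
  | succ l =>
    simp only [Disk.IsSuffix, Nat.succ_ne_zero, false_and, false_or, ne_eq, not_false_eq_true,
      true_and, Nat.add_sub_cancel]
    refine and_congr_right fun _ => ⟨?_, ?_⟩
    · rintro ⟨i', hi', j', hj', h1, h2⟩
      lift i' to Fin n using hi'
      lift j' to Fin n using hj'
      exact ⟨i', j', (h.entry l i' j' (address_lt_address (by omega) _ _)).1 h1,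
        (h.compatible_iff ht _ _ _ _).1 h2⟩
    · rintro ⟨i', j', h1, h2⟩
      exact ⟨i', i'.2, j', j'.2, (h.entry l i' j' (address_lt_address (by omega) _ _)).2 h1,
        (h.compatible_iff ht _ _ _ _).2 h2⟩

theorem TableBelow.layerCmd {l : ℕ} {i j : Fin n} (h : TableBelow D t (address n l i j) m)
    (v : Unit) : TableBelow D t (address n l i j + 1) (layerCmd m (((v, l), i), j)) := by
  refine ⟨h.toHolds.setNat (by omega) _ _, fun l' i' j' hlt => ?_⟩
  simp only [RealRAM.layerCmd, h.size, State.setNat_nat, Function.update_self]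
  by_cases he : address n l' i' j' = address n l i j
  · obtain ⟨rfl, rfl, rfl⟩ := address_injective he
    rw [Function.update_self, ← h.layerTest_iff ht]
    split_ifs with hl <;> simp [hl]
  · rw [Function.update_of_ne he]
    exact h.entry _ _ _ (by omega)

/-- The nested loops visit consecutive addresses: finishing a row moves the bound of the invariant
by `n`, exactly to the start of the next row. -/
theorem TableBelow.rowCmd {l : ℕ} {i : Fin n} (h : TableBelow D t (address n l i 0) m) (v : Unit) :
    TableBelow D t (address n l (i + 1) 0) (rowCmd m ((v, l), i)) := by
  have := State.iterate_induction (f := fun m' j => RealRAM.layerCmd m' (((v, l), i), j))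
    (fun j m' => TableBelow D t (address n l i 0 + j) m') n h fun j hj m' h' => by
      lift j to Fin n using hj
      exact TableBelow.layerCmd (i := i) (j := j) ht h' v
  rw [RealRAM.rowCmd, h.size]
  convert this using 1
  simp only [address]
  ring

theorem TableBelow.planeCmd {l : ℕ} (h : TableBelow D t (address n l 0 0) m) (v : Unit) :
    TableBelow D t (address n (l + 1) 0 0) (planeCmd m (v, l)) := by
  have := State.iterate_induction (f := fun m' i => RealRAM.rowCmd m' ((v, l), i))
    (fun i m' => TableBelow D t (address n l i 0) m') n h fun i hi m' h' => by
      lift i to Fin n using hi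
      exact h'.rowCmd ht v
  rw [RealRAM.planeCmd, h.size]
  convert this using 1
  simp only [address]
  ring

theorem tableBelow_tableCmd (v : Unit) :
    TableBelow D t (address n n 0 0) (tableCmd (input D) v) :=
  State.iterate_induction (f := fun m' l => RealRAM.planeCmd m' (v, l))
    (fun l m' => TableBelow D t (address n l 0 0) m') n
    -- The first address is `0`, so nothing is claimed about the table initially.
    ⟨holds_input, fun l i j hlt => by simp [address] at hlt⟩ fun l _ m' h' => h'.planeCmd ht v

/-- The memory contains the disks, the table, and the greatest length `M` of a sequence of groups
that covers all disks (or `0`). -/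
structure Prepared (D : Fin n → Disk) (t : Fin n → ℝ) (M : ℕ) (m : State) : Prop
    extends Holds D m where
  entry : ∀ l < n, ∀ i j : Fin n, m.nat 2 (address n l i j) = 1 ↔ Disk.IsSuffix D t l i j
  length : m.nat 3 0 = M
  le : M ≤ n
  start : M ≠ 0 → ∃ i j, Disk.IsSuffix D t (M - 1) i j ∧ (Disk.leftOf D t i j).card = 0
  lt : ∀ l < n, ∀ i j, Disk.IsSuffix D t l i j → (Disk.leftOf D t i j).card = 0 → l < M

theorem exists_prepared (v : Unit) : ∃ M, Prepared D t M (lengthCmd (tableCmd (input D) v) v) := by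
  have h := tableBelow_tableCmd ht v
  set m := tableCmd (input D) v
  have hentry : ∀ l < n, ∀ i j : Fin n,
      m.nat 2 (address n l i j) = 1 ↔ Disk.IsSuffix D t l i j := fun l hl i j =>
    h.entry l i j (address_lt_address hl _ _)
  have hstart : ∀ l < n, StartTest m l ↔
      ∃ i j, Disk.IsSuffix D t l i j ∧ (Disk.leftOf D t i j).card = 0 := by
    intro l hl
    rw [StartTest, h.size]
    constructor
    · rintro ⟨i, hi, j, hj, h1, h2⟩
      lift i to Fin n using hi
      lift j to Fin n using hj
      exact ⟨i, j, (hentry l hl i j).1 h1, (h.groupStart_eq ht i j).symm.trans h2⟩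
    · rintro ⟨i, j, h1, h2⟩
      exact ⟨i, i.2, j, j.2, (hentry l hl i j).2 h1, (h.groupStart_eq ht i j).trans h2⟩
  -- Layer `l` stands for `l + 1` groups, so the successor of the greatest successful layer is the
  -- length itself, and `0` is left to mean that there is none.
  refine ⟨greatestSucc n (StartTest m), h.toHolds.setNat (by omega) _ _, hentry, ?_, ?_, ?_, ?_⟩
  · simp [lengthCmd, h.size]
  · by_cases h0 : greatestSucc n (StartTest m) = 0
    · omega
    · exact (greatestSucc_spec h0).1
  · intro h0
    have h1 := greatestSucc_spec h0
    exact (hstart _ (by omega)).1 h1.2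
  · intro l hl i j h1 h2
    exact (lt_greatestSucc_iff l).2 ⟨l, hl, le_rfl, (hstart l hl).2 ⟨i, j, h1, h2⟩⟩

/-- The group `(i, j)` can be number `q` in a sequence of `M` groups, where `(i', j')` is its
predecessor. -/
def IsChoice (D : Fin n → Disk) (t : Fin n → ℝ) (M q : ℕ) (i' j' i j : Fin n) : Prop :=
  Disk.IsSuffix D t (M - 1 - q) i j ∧ (q = 0 → (Disk.leftOf D t i j).card = 0) ∧
    (q ≠ 0 → Disk.IsNext D t i' j' i j)

theorem Prepared.choiceTest_iff {M q : ℕ} (h : Prepared D t M m) (hq : q < M) {i' j' : Fin n}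
    (hij : q ≠ 0 → m.nat 4 (q - 1) = i' ∧ m.nat 5 (q - 1) = j') (i j : Fin n) :
    ChoiceTest m q i j ↔ IsChoice D t M q i' j' i j := by
  have hM := h.le
  rw [ChoiceTest, IsChoice, h.size, h.length, h.entry _ (by omega), h.groupStart_eq ht]
  refine and_congr_right fun _ => and_congr_right fun _ => ?_
  refine forall_congr' fun h0 => ?_
  rw [(hij h0).1, (hij h0).2, h.compatible_iff ht]

omit ht in
theorem Prepared.setNat {M : ℕ} (h : Prepared D t M m) {a : ℕ} (ha : 4 ≤ a ∨ a = 1) (k v : ℕ) :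
    Prepared D t M (m.setNat a k v) where
  toHolds := h.toHolds.setNat (by omega) k v
  entry l hl i j := by
    simpa [Function.update_of_ne (show 2 ≠ a by omega)] using h.entry l hl i j
  length := by simpa [Function.update_of_ne (show 3 ≠ a by omega)] using h.length
  le := h.le
  start := h.start
  lt := h.lt

/-- The group number `r` has been chosen. -/
def Chosen (D : Fin n → Disk) (t : Fin n → ℝ) (M r : ℕ) (m : State) : Prop :=
  ∃ i' j' i j : Fin n, (r ≠ 0 → m.nat 4 (r - 1) = i' ∧ m.nat 5 (r - 1) = j') ∧
    m.nat 4 r = i ∧ m.nat 5 r = j ∧ IsChoice D t M r i' j' i j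

/-- A choice exists because the previous group starts a suffix with one more group, whose definition
provides a compatible successor; for `q = 0` it comes from `Prepared.start`. -/
theorem Prepared.chosen_step {M q : ℕ} (h : Prepared D t M m) (hq : q < M)
    (hprev : q ≠ 0 → Chosen D t M (q - 1) m) (v : Unit) :
    Chosen D t M q (lastCmd (centreCmd m (v, q)) (v, q)) := by
  obtain ⟨i', j', hij, i, j, hc⟩ : ∃ i' j' : Fin n,
      (q ≠ 0 → m.nat 4 (q - 1) = i' ∧ m.nat 5 (q - 1) = j') ∧
        ∃ i j, IsChoice D t M q i' j' i j := by
    by_cases h0 : q = 0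
    · subst h0
      obtain ⟨i, j, h1, h2⟩ := h.start (by omega)
      -- There is no predecessor here; `i` and `j` merely fill its place.
      exact ⟨i, j, fun h => absurd rfl h, i, j, h1, fun _ => h2, fun h => absurd rfl h⟩
    · obtain ⟨-, -, i', j', -, h1, h2, h3, -⟩ := hprev h0
      rw [show M - 1 - (q - 1) = M - 1 - q + 1 by omega] at h3
      obtain ⟨-, i, j, h4, h5⟩ := h3
      exact ⟨i', j', fun _ => ⟨h1, h2⟩, i, j, h4, fun h => absurd h h0, fun _ => h5⟩
  have hi := leastBelow_spec (n := n) (P := fun i => ∃ j < n, ChoiceTest m q i j)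
    ⟨i, i.2, j, j.2, (h.choiceTest_iff ht hq hij i j).2 hc⟩
  have hsize : (centreCmd m (v, q)).nat 0 0 = n := h.size
  have hcentre : (centreCmd m (v, q)).nat 4 q =
      leastBelow n fun i => ∃ j < n, ChoiceTest m q i j := by
    simp [centreCmd, h.size]
  set i₀ := leastBelow n fun i => ∃ j < n, ChoiceTest m q i j
  obtain ⟨hi₀, j₁, hj₁, hc₁⟩ := hi
  clear_value i₀
  lift i₀ to Fin n using hi₀
  lift j₁ to Fin n using hj₁
  -- Storing the centre at index `q` does not affect the test, which reads the chosen groups only at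
  -- index `q - 1`.
  have h' : Prepared D t M (centreCmd m (v, q)) := h.setNat (.inl le_rfl) _ _
  have hij' : q ≠ 0 → (centreCmd m (v, q)).nat 4 (q - 1) = i' ∧
      (centreCmd m (v, q)).nat 5 (q - 1) = j' := fun h0 => by
    simpa [centreCmd, Function.update_of_ne (show q - 1 ≠ q by omega)] using hij h0
  have hj := leastBelow_spec (n := n) (P := fun j => ChoiceTest (centreCmd m (v, q)) q i₀ j)
    ⟨j₁, j₁.2, (h'.choiceTest_iff ht hq hij' _ _).2 ((h.choiceTest_iff ht hq hij _ _).1 hc₁)⟩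
  have hlast : (lastCmd (centreCmd m (v, q)) (v, q)).nat 5 q =
      leastBelow n fun j => ChoiceTest (centreCmd m (v, q)) q i₀ j := by
    simp [lastCmd, hsize, hcentre]
  set j₀ := leastBelow n fun j => ChoiceTest (centreCmd m (v, q)) q i₀ j
  obtain ⟨hj₀, hc₀⟩ := hj
  clear_value j₀
  lift j₀ to Fin n using hj₀
  refine ⟨i', j', i₀, j₀, fun h0 => ?_, ?_, hlast, (h'.choiceTest_iff ht hq hij' _ _).1 hc₀⟩
  · simpa [lastCmd, Function.update_of_ne (show q - 1 ≠ q by omega)] using hij' h0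
  · simpa [lastCmd] using hcentre

theorem Prepared.choiceCmd {M : ℕ} (h : Prepared D t M m) (v : Unit) :
    Prepared D t M (choiceCmd m v) ∧ ∀ r < M, Chosen D t M r (choiceCmd m v) := by
  have := State.iterate_induction
    (f := fun m' q => lastCmd (centreCmd m' (v, q)) (v, q))
    -- The loop also runs for `q` from `M` on and stores meaningless values there; the invariant
    -- speaks only of indices below `M`.
    (fun q m' => Prepared D t M m' ∧ ∀ r < q, r < M → Chosen D t M r m') n
    ⟨h, fun r hr => absurd hr (by omega)⟩ ?_
  · rw [RealRAM.choiceCmd, h.size]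
    exact ⟨this.1, fun r hr => this.2 r (hr.trans_le h.le) hr⟩
  · rintro q _ m' ⟨h1, h2⟩
    refine ⟨(h1.setNat (.inl le_rfl) _ _).setNat (.inl (by omega)) _ _, fun r hr hrM => ?_⟩
    rcases (Nat.lt_succ_iff.1 hr).eq_or_lt with rfl | hr
    · exact h1.chosen_step ht hrM (fun h0 => h2 _ (by omega) (by omega)) v
    · obtain ⟨i', j', i, j, h3, h4, h5, h6⟩ := h2 r hr hrM
      refine ⟨i', j', i, j, fun h0 => ?_, ?_, ?_, h6⟩
      · simpa [lastCmd, centreCmd, Function.update_of_ne (show r - 1 ≠ q by omega)] using h3 h0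
      · simpa [lastCmd, centreCmd, Function.update_of_ne (show r ≠ q by omega)] using h4
      · simpa [lastCmd, centreCmd, Function.update_of_ne (show r ≠ q by omega)] using h5

omit ht in
theorem exists_isChain {M : ℕ} (hM : M ≠ 0) (h : ∀ r < M, Chosen D t M r m) :
    ∃ I J : ℕ → Fin n, Disk.IsChain D t M I J ∧ ∀ q < M, m.nat 4 q = I q ∧ m.nat 5 q = J q := by
  obtain ⟨i₀, -⟩ := h 0 (by omega)
  -- The sequences are total functions, so indices from `M` on receive the dummy `i₀`.
  have h' : ∀ q, ∃ i j : Fin n, q < M → m.nat 4 q = i ∧ m.nat 5 q = j ∧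
      Disk.IsSuffix D t (M - 1 - q) i j ∧ (q = 0 → (Disk.leftOf D t i j).card = 0) ∧
      (q ≠ 0 → ∃ i' j' : Fin n, m.nat 4 (q - 1) = i' ∧ m.nat 5 (q - 1) = j' ∧
        Disk.IsNext D t i' j' i j) := by
    intro q
    by_cases hq : q < M
    · obtain ⟨i', j', i, j, h1, h2, h3, h4, h5, h6⟩ := h q hq
      exact ⟨i, j, fun _ => ⟨h2, h3, h4, h5, fun h0 =>
        ⟨i', j', (h1 h0).1, (h1 h0).2, h6 h0⟩⟩⟩
    · exact ⟨i₀, i₀, fun h => absurd h hq⟩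
  choose I J hIJ using h'
  refine ⟨I, J, ⟨by omega, fun q hq => (hIJ q hq).2.2.1.isValidGroup,
    (hIJ 0 (by omega)).2.2.2.1 rfl, fun q hq => ?_, ?_⟩, fun q hq => ⟨(hIJ q hq).1, (hIJ q hq).2.1⟩⟩
  · obtain ⟨i', j', h1, h2, h3⟩ := (hIJ (q + 1) hq).2.2.2.2 (by omega)
    obtain ⟨h4, h5, -⟩ := hIJ q (by omega)
    rw [Nat.add_sub_cancel] at h1 h2
    obtain rfl : I q = i' := Fin.ext (h4.symm.trans h1)
    obtain rfl : J q = j' := Fin.ext (h5.symm.trans h2)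
    exact h3
  · have := (hIJ (M - 1) (by omega)).2.2.1
    rw [Nat.sub_self] at this
    exact this.2

variable (hD : ∀ i j, Disk.distance D i j = |t i - t j|)
include hD

omit ht in
-- The groups of a chain are disjoint, so the sum in `assignCmd` reduces to the term of the one
-- group that contains `k`.
theorem Prepared.assign_eq {M : ℕ} (h : Prepared D t M m) {I J : ℕ → Fin n}
    (hc : Disk.IsChain D t M I J) (hIJ : ∀ q < M, m.nat 4 q = I q ∧ m.nat 5 q = J q) {q : ℕ}
    (hq : q < M) {k : Fin n} (hk : k ∈ Disk.group D (I q) (J q)) (v : Unit) (m' : State)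
    (hm' : ∀ a, a ≠ 1 → m'.nat a = m.nat a) (hr : m'.real = m.real) :
    (assignCmd m' (v, k)).nat 1 k = I q := by
  have hm : Holds D m' := ⟨by rw [hm' 0 (by omega), h.size], by rw [hr, h.real]⟩
  have hM := h.le
  simp only [assignCmd, State.setNat_nat, Function.update_self, hm.size]
  rw [hm' 3 (by omega), hm' 4 (by omega), hm' 5 (by omega), h.length,
    Finset.sum_eq_single_of_mem q (Finset.mem_range.2 (by omega))]
  · rw [(hIJ q hq).1, (hIJ q hq).2, if_pos ⟨hq, (hm.inGroup_iff _ _ _).2 hk⟩]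
  · intro r _ hrq
    rw [if_neg]
    rintro ⟨hrM, hg⟩
    rw [(hIJ r hrM).1, (hIJ r hrM).2, hm.inGroup_iff] at hg
    exact hrq (hc.eq_of_mem_group hD hrM hq hg hk)

omit ht in
theorem Prepared.outputCmd {M : ℕ} (h : Prepared D t M m) {I J : ℕ → Fin n}
    (hc : Disk.IsChain D t M I J) (hIJ : ∀ q < M, m.nat 4 q = I q ∧ m.nat 5 q = J q) (v : Unit) :
    ∀ q < M, ∀ k ∈ Disk.group D (I q) (J q), (outputCmd m v).nat 1 k = I q := by
  have := State.iterate_induction (f := fun m' k => assignCmd m' (v, k))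
    (fun p m' => (∀ a, a ≠ 1 → m'.nat a = m.nat a) ∧ m'.real = m.real ∧
      ∀ k : Fin n, k < p → ∀ q < M, k ∈ Disk.group D (I q) (J q) → m'.nat 1 k = I q) n
    ⟨fun _ _ => rfl, rfl, fun k hk => absurd hk (by omega)⟩ ?_
  · rw [RealRAM.outputCmd, h.size]
    exact fun q hq k hk => this.2.2 k k.2 q hq hk
  · rintro p _ m' ⟨h1, h2, h3⟩
    refine ⟨fun a ha => ?_, h2, fun k hkp q hq hk => ?_⟩
    · simp [assignCmd, Function.update_of_ne ha, h1 a ha]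
    · rcases (Nat.lt_succ_iff.1 hkp).eq_or_lt with rfl | hkp
      · exact h.assign_eq hD hc hIJ hq hk v m' h1 h2
      · have := h3 k hkp q hq hk
        simpa [assignCmd, Function.update_of_ne (show (k : ℕ) ≠ p by omega)] using this

omit hD ht in
theorem outputCmd_length (v : Unit) : (outputCmd m v).nat 3 = m.nat 3 :=
  State.iterate_induction (fun _ m' => m'.nat 3 = m.nat 3) _ rfl fun k _ m' h => by
    simpa [assignCmd] using h

theorem solves_solveCmd (v : Unit) : Solves D (solveCmd (input D) v) := by
  obtain ⟨M, h₁⟩ := exists_prepared ht v (D := D)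
  obtain ⟨h₂, hchosen⟩ := h₁.choiceCmd ht v
  rw [solveCmd]
  set m := RealRAM.choiceCmd (lengthCmd (tableCmd (input D) v) v) v
  have hsize : (outputCmd m v).nat 0 0 = n := (outputCmd_size m v).trans h₂.size
  have hlength : (outputCmd m v).nat 3 0 = M := by rw [outputCmd_length, h₂.length]
  -- A cardinality `l + 1` is at most `n`, so layer `l` is within the table and is counted in `M`.
  have hupper : 0 < n → ∀ ψ, Disk.IsProper D ψ → Disk.cardinality ψ ≤ M := by
    intro hn ψ hψ
    obtain ⟨l, i, j, h1, h2, h3⟩ := hψ.exists_isSuffix hD hn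
    have := Disk.cardinality_le ψ
    have := h₂.lt l (by omega) i j h2 h3
    omega
  have hone : (reportCmd (outputCmd m v) v).nat 1 = (outputCmd m v).nat 1 := by simp [reportCmd]
  have hzero : (reportCmd (outputCmd m v) v).nat 0 0 = if n ≠ 0 ∧ M = 0 then 0 else 1 := by
    simp [reportCmd, hsize, hlength]
  rw [Solves, hone, hzero]
  by_cases hM : M = 0
  -- For `n = 0` there are no groups, yet the empty assignment is proper; hence the test `n ≠ 0` in
  -- the report.
  · rcases Nat.eq_zero_or_pos n with hn | hn
    · left
      subst hn
      refine ⟨by simp, Fin.elim0, ⟨⟨fun i => i.elim0, fun i => i.elim0, fun i => i.elim0,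
        fun i => i.elim0⟩, fun ψ _ => ?_⟩, fun i => i.elim0⟩
      exact (Disk.cardinality_le ψ).trans (Nat.zero_le _)
    · right
      refine ⟨if_pos ⟨by omega, hM⟩, fun ⟨φ, hφ⟩ => ?_⟩
      obtain ⟨l, -, -, h1, -⟩ := hφ.exists_isSuffix hD hn
      have := hupper hn φ hφ
      omega
  · left
    obtain ⟨I, J, hc, hIJ⟩ := exists_isChain hM hchosen
    have hout := h₂.outputCmd hD hc hIJ v
    have hφ : ∀ k : Fin n, ∃ i : Fin n, (outputCmd m v).nat 1 k = i ∧
        ∀ q < M, k ∈ Disk.group D (I q) (J q) → i = I q := fun k => by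
      obtain ⟨q, hq, hk⟩ := hc.exists_mem_group hD k
      refine ⟨I q, hout q hq k hk, fun r hr hkr => ?_⟩
      rw [hc.eq_of_mem_group hD hq hr hk hkr]
    choose φ hφ using hφ
    have hφ' : ∀ q < M, ∀ k ∈ Disk.group D (I q) (J q), φ k = I q := fun q hq k hk =>
      (hφ k).2 q hq hk
    refine ⟨if_neg fun hn => hM hn.2, φ, ⟨hc.isProper hD hφ', fun ψ hψ => ?_⟩, fun i => (hφ i).1⟩
    rw [hc.cardinality_eq hD hφ']
    exact hupper (I 0).pos ψ hψ

end correctness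

end RealRAM

/-- One fixed program finds, for all finite families of disks with collinear centres, a proper
assignment of maximum cardinality (or detects that there is no proper assignment), within a number
of steps that is polynomial in the number of disks. -/
theorem theorem3 :
    ∃ (p : RealRAM.Prog) (T : Polynomial ℕ),
      ∀ (n : ℕ) (D : Fin n → Disk), Collinear ℝ (Set.range fun i => (D i).centre) →
        ∃ (s : RealRAM.State) (t : ℕ),
          RealRAM.Runs p (RealRAM.input D) s t ∧ t ≤ T.eval n ∧ RealRAM.Solves D s := by
  obtain ⟨p, T, h⟩ := RealRAM.CmdPoly.solveCmd () 10 le_rfl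
  refine ⟨p, T, fun n D hcol => ?_⟩
  obtain ⟨t, hD, ht⟩ := Disk.exists_position hcol
  obtain ⟨s, u, h1, h2, h3, -⟩ := h (RealRAM.input D) () (RealRAM.input D)
    (RealRAM.AgreeBelow.refl _ _) trivial
  refine ⟨s, u, h1, h2, ?_⟩
  -- The machine's final memory agrees with `solveCmd` on the arrays below `10`, and `Solves`
  -- inspects only the integer arrays `0` and `1`.
  have := RealRAM.solves_solveCmd ht hD ()
  rwa [RealRAM.Solves, ← (h3 0 (by omega)).1, ← (h3 1 (by omega)).1] at this
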